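/- Let $\Lambda$ be a finite lattice, $\mathcal H=\bigotimes_{x\in\Lambda}\mathbb C^d$, and let $\mathcal L(s)=\sum_{i=1}^K\mathcal L_i(s)$, $s\ge 0$, be a $k$-local time-dependent Liouvillian: each $\mathcal L_i:[0,\infty)\to\mathcal B(\mathcal B(\mathcal H))$ is piecewise continuous (finitely many discontinuities in every bounded interval, finite one-sided limits) and acts non-trivially on at most $k$ fixed sites, i.e. $\mathcal L_i(s)=\ell_i(s)\otimes\mathrm{id}$ with $\ell_i(s)$ acting on the operators on these sites. No $\mathcal L_i$ is assumed to generate completely positive maps. Let $T_{\mathcal L}(r,s)$ and $T_{\mathcal L_i}(r,s)$, $r\ge s\ge 0$, be the propagators, i.e. the solutions of $\partial_r T_{\mathcal L}(r,s)=\mathcal L(r)T_{\mathcal L}(r,s)$, $T_{\mathcal L}(s,s)=\mathrm{id}$, and likewise for $\mathcal L_i$. Let $\|T\|_{1\to1}=\sup_{\|A\|_1=1}\|T(A)\|_1$ with the Schatten 1-norm. Fix $t\ge 0$. For $m\ge1$, $1\le j\le m$, $1\le i\le K$ put $T_i^j=T_{\mathcal L_i}(tj/m,t(j-1)/m)$.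 Let $\tilde N_i^m$ be the number of $j\in\{1,\dots,m\}$ such that $T_i^j$ is not a quantum channel (completely positive and trace preserving), and let $C_i^m$ be the number of $j\in\{1,\dots,m-1\}$ such that $T_i^j$ is a quantum channel and $T_i^{j+1}$ is not. Assume that the limits $t_i^{\mathrm{ID}}=\lim_{m\to\infty}\tilde N_i^m t/m$ and $C_i=\lim_{m\to\infty}C_i^m$ exist and are finite, and put $t^{\mathrm{ID}}=\max_i t_i^{\mathrm{ID}}$, $\tilde C=2\max_i C_i$ and $\beta=\sup_{0\le s\le t}\max_i\|\mathcal L_i(s)\|_{1\to1}$ (maxima over an empty index set are $0$). (1) If $$0\le\epsilon\le\frac{2K^2\beta t\,\ln(2)\,e^{(K+K^2)t^{\mathrm{ID}}\beta}}{3+[3+\tilde CK+\tilde CK^2]}$$ and the integer $m\ge1$ satisfies $m\,\epsilon\ge 2K^2\beta^2t^2e^{(K+K^2)t^{\mathrm{ID}}\beta}$ (for $\epsilon>0$: $m\ge 2K^2\beta^2t^2e^{(K+K^2)t^{\mathrm{ID}}\beta}/\epsilon$), then $$\Big\|T_{\mathcal L}(t,0)-\prod_{j=1}^m\prod_{i=1}^KT_i^j\Big\|_{1\to1}\le\epsilon,$$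 where in both products factors with larger index stand on the left. So a number $m$ of steps that is exponential in $(K+K^2)\,t^{\mathrm{ID}}\beta$ suffices. (2) If the dynamics is locally divisible on $[0,t]$, i.e. $T_{\mathcal L_i}(r,s)$ is a quantum channel for all $i$ and all $0\le s\le r\le t$, then all the limits $t_i^{\mathrm{ID}}$ and $C_i$ exist and equal $0$; hence for $0\le\epsilon\le 2K^2\beta t\ln(2)/6$ the same bound holds as soon as $m\ge1$ and $m\,\epsilon\ge2K^2\beta^2t^2$, which is polynomial in $K$. -/

import Mathlib

open Set Filter Topology MeasureTheory

section VolterraSeries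

/-- Iterated integrals (Dyson series) for the linear initial value problem `U' = L U`, `U s = 1`. -/
noncomputable def dysonTerm {E : Type*} [NormedRing E] [NormedAlgebra ℝ E]
    (L : ℝ → E) (s : ℝ) : ℕ → ℝ → E
  | 0 => fun _ => 1
  | n + 1 => fun r => ∫ u in s..r, L u * dysonTerm L s n u

theorem integral_bound_step (s r M C : ℝ) (n : ℕ) :
    (∫ u in s..r, M * (C * ((M * (u - s)) ^ n / n.factorial))) =
      C * ((M * (r - s)) ^ (n + 1) / (n + 1).factorial) := by
  have h2 : (∫ u in s..r, M * (C * ((M * (u - s)) ^ n / n.factorial))) =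
      M * (C * (M ^ n / n.factorial)) * ∫ u in s..r, (u - s) ^ n := by
    rw [← intervalIntegral.integral_const_mul]
    congr 1
    ext u
    rw [mul_pow]
    ring
  rw [h2, intervalIntegral.integral_comp_sub_right (fun u => u ^ n), integral_pow]
  have : ((n + 1).factorial : ℝ) = (n + 1) * n.factorial := by
    push_cast [Nat.factorial_succ]; ring
  rw [this, mul_pow]
  have h3 : (n.factorial : ℝ) ≠ 0 := by positivity
  have h4 : (n : ℝ) + 1 ≠ 0 := by positivity
  field_simp
  simp
  ring

theorem intervalIntegrable_of_bounded_of_continuousOn {W : Type*} [NormedAddCommGroup W]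
    {f : ℝ → W} {s R M : ℝ} (F : Finset ℝ) (hsR : s ≤ R)
    (hM : ∀ u ∈ Icc s R, ‖f u‖ ≤ M) (hc : ContinuousOn f (Icc s R \ F)) :
    IntervalIntegrable f volume s R := by
  have h2 : AEStronglyMeasurable f (volume.restrict (Icc s R \ F)) :=
    hc.aestronglyMeasurable (measurableSet_Icc.diff F.measurableSet)
  have h3 : volume.restrict (Icc s R \ (F : Set ℝ)) = volume.restrict (Icc s R) :=
    Measure.restrict_congr_set (sdiff_null_ae_eq_self (F.finite_toSet.measure_zero volume))
  rw [h3] at h2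
  rw [intervalIntegrable_iff_integrableOn_Icc_of_le hsR]
  exact Integrable.of_bound h2 M ((ae_restrict_iff' measurableSet_Icc).2 (Eventually.of_forall hM))

theorem dysonTerm_bound {E : Type*} [NormedRing E] [NormedAlgebra ℝ E]
    (L : ℝ → E) (s R M : ℝ) (hM : ∀ u ∈ Icc s R, ‖L u‖ ≤ M) (n : ℕ) :
    ∀ r ∈ Icc s R, ‖dysonTerm L s n r‖ ≤ ‖(1 : E)‖ * ((M * (r - s)) ^ n / n.factorial) := by
  induction n with
  | zero => intro r _; simp [dysonTerm]
  | succ n ih =>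
    intro r hr
    have hM0 : 0 ≤ M := (norm_nonneg _).trans (hM r hr)
    have h1 : ‖dysonTerm L s (n + 1) r‖ ≤
        ∫ u in s..r, M * (‖(1 : E)‖ * ((M * (u - s)) ^ n / n.factorial)) := by
      refine intervalIntegral.norm_integral_le_of_norm_le hr.1 ?_ ?_
      · refine Eventually.of_forall fun u hu => ?_
        have hu' : u ∈ Icc s R := ⟨hu.1.le, hu.2.trans hr.2⟩
        exact (norm_mul_le _ _).trans
          (mul_le_mul (hM u hu') (ih u hu') (norm_nonneg _) hM0)
      · exact Continuous.intervalIntegrable (by fun_prop) _ _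
    exact h1.trans (le_of_eq (integral_bound_step s r M _ n))

theorem dysonTerm_continuousOn {E : Type*} [NormedRing E] [NormedAlgebra ℝ E]
    (L : ℝ → E) (s : ℝ) (hi : ∀ R, s ≤ R → IntervalIntegrable L volume s R) (n : ℕ) :
    ∀ R, s ≤ R → ContinuousOn (dysonTerm L s n) (Icc s R) := by
  induction n with
  | zero => intro R _; exact continuousOn_const
  | succ n ih =>
    intro R hR
    have h1 : IntervalIntegrable (fun u => L u * dysonTerm L s n u) volume s R :=
      (hi R hR).mul_continuousOn (by rw [uIcc_of_le hR]; exact ih R hR)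
    have h2 := intervalIntegral.continuousOn_primitive_interval' h1 left_mem_uIcc
    rwa [uIcc_of_le hR] at h2

/-- Existence for the linear initial value problem in a Banach algebra. -/
theorem exists_linear_ivp {E : Type*} [NormedRing E] [NormedAlgebra ℝ E] [CompleteSpace E]
    (L : ℝ → E) (s : ℝ) (hi : ∀ R, s ≤ R → IntervalIntegrable L volume s R)
    (hb : ∀ R, s ≤ R → ∃ M, ∀ u ∈ Icc s R, ‖L u‖ ≤ M) :
    ∃ U : ℝ → E, U s = 1 ∧ ContinuousOn U (Ici s) ∧
      ∀ r, s < r → ContinuousAt L r → HasDerivAt U (L r * U r) r := by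
  set D := dysonTerm L s with hD
  set U : ℝ → E := fun r => ∑' n, D n r with hU
  have key : ∀ R, s ≤ R → ∃ b : ℕ → ℝ, Summable b ∧ ∀ n, ∀ r ∈ Icc s R, ‖D n r‖ ≤ b n := by
    intro R hR
    obtain ⟨M, hM⟩ := hb R hR
    have hM0 : 0 ≤ M := (norm_nonneg _).trans (hM s ⟨le_rfl, hR⟩)
    refine ⟨fun n => ‖(1 : E)‖ * ((M * (R - s)) ^ n / n.factorial),
      (Real.summable_pow_div_factorial _).mul_left _, fun n r hr => ?_⟩
    refine (dysonTerm_bound L s R M hM n r hr).trans ?_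
    have : 0 ≤ r - s := sub_nonneg.2 hr.1
    have h2 : r - s ≤ R - s := sub_le_sub_right hr.2 s
    beta_reduce
    gcongr
  have hcont : ∀ R, s ≤ R → ContinuousOn U (Icc s R) := by
    intro R hR
    obtain ⟨b, hbs, hbd⟩ := key R hR
    exact continuousOn_tsum (fun n => dysonTerm_continuousOn L s hi n R hR) hbs hbd
  have hint : ∀ R, s ≤ R → IntervalIntegrable (fun u => L u * U u) volume s R := fun R hR =>
    (hi R hR).mul_continuousOn (by rw [uIcc_of_le hR]; exact hcont R hR)
  have heq : ∀ r, s ≤ r → U r = 1 + ∫ u in s..r, L u * U u := by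
    intro r hr
    obtain ⟨b, hbs, hbd⟩ := key r hr
    obtain ⟨M, hM⟩ := hb r hr
    have hM0 : 0 ≤ M := (norm_nonneg _).trans (hM s ⟨le_rfl, hr⟩)
    have hsum : ∀ u ∈ Icc s r, HasSum (fun n => D n u) (U u) := fun u hu =>
      (Summable.of_norm_bounded hbs (fun n => hbd n u hu)).hasSum
    have h1 : HasSum (fun n => ∫ u in s..r, L u * D n u) (∫ u in s..r, L u * U u) := by
      refine intervalIntegral.hasSum_integral_of_dominated_convergence
        (fun n _ => M * b n) (fun n => ?_) (fun n => ?_) ?_ ?_ ?_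
      · exact ((hi r hr).mul_continuousOn (by
          rw [uIcc_of_le hr]
          exact dysonTerm_continuousOn L s hi n r hr)).aestronglyMeasurable_restrict_uIoc
      · refine Eventually.of_forall fun u hu => ?_
        rw [uIoc_of_le hr] at hu
        have hu' : u ∈ Icc s r := ⟨hu.1.le, hu.2⟩
        exact (norm_mul_le _ _).trans
          (mul_le_mul (hM u hu') (hbd n u hu') (norm_nonneg _) hM0)
      · exact Eventually.of_forall fun u _ => hbs.mul_left M
      · exact Continuous.intervalIntegrable continuous_const _ _
      · refine Eventually.of_forall fun u hu => ?_
        rw [uIoc_of_le hr] at hu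
        exact (hsum u ⟨hu.1.le, hu.2⟩).mul_left (L u)
    have h2 : HasSum (fun n => D (n + 1) r) (∫ u in s..r, L u * U u) := h1
    have h3 : HasSum (fun n => D n r) (D 0 r + ∫ u in s..r, L u * U u) :=
      HasSum.zero_add (f := fun n => D n r) h2
    exact (hsum r ⟨hr, le_rfl⟩).unique h3
  refine ⟨U, ?_, ?_, ?_⟩
  · rw [heq s le_rfl]; simp
  · intro r hr
    have h1 : ContinuousWithinAt U (Icc s (r + 1)) r :=
      hcont (r + 1) (by have := mem_Ici.1 hr; linarith) r ⟨hr, by linarith⟩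
    refine h1.mono_of_mem_nhdsWithin ?_
    rw [← Ici_inter_Iic]
    exact inter_mem self_mem_nhdsWithin (mem_nhdsWithin_of_mem_nhds (Iic_mem_nhds (by linarith)))
  · intro r hr hc
    have hUr : ContinuousAt U r :=
      (hcont (r + 1) (by linarith)).continuousAt (Icc_mem_nhds hr (by linarith))
    have hmeas : StronglyMeasurableAtFilter (fun u => L u * U u) (𝓝 r) volume :=
      ⟨Ioc s (r + 1), Ioc_mem_nhds hr (by linarith),
        (hint (r + 1) (by linarith)).aestronglyMeasurable⟩
    have h1 : HasDerivAt (fun x => 1 + ∫ u in s..x, L u * U u) (L r * U r) r :=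
      (intervalIntegral.integral_hasDerivAt_right (hint r hr.le) hmeas
        (hc.mul hUr)).const_add 1
    refine h1.congr_of_eventuallyEq ?_
    filter_upwards [Ioi_mem_nhds hr] with x hx
    exact heq x (le_of_lt hx)

/-- A function with finite one-sided limits is bounded in norm on bounded intervals. -/
theorem bounded_of_oneSidedLimits {V : Type*} [NormedAddCommGroup V] [NormedSpace ℂ V]
    [FiniteDimensional ℂ V] (L : ℝ → V →ₗ[ℂ] V)
    (hr : ∀ r, 0 ≤ r → ∃ l : V →ₗ[ℂ] V, ∀ A, Tendsto (fun u => L u A) (𝓝[>] r) (𝓝 (l A)))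
    (hl : ∀ r, 0 < r → ∃ l : V →ₗ[ℂ] V, ∀ A, Tendsto (fun u => L u A) (𝓝[<] r) (𝓝 (l A)))
    (s R : ℝ) (hs : 0 ≤ s) :
    ∃ M, ∀ u ∈ Icc s R, ‖LinearMap.toContinuousLinearMap (L u)‖ ≤ M := by
  have : CompleteSpace V := FiniteDimensional.complete ℂ V
  have hbdA : ∀ A, ∃ M, ∀ u ∈ Icc s R, ‖L u A‖ ≤ M := by
    intro A
    refine isCompact_Icc.induction_on (p := fun S => ∃ M, ∀ u ∈ S, ‖L u A‖ ≤ M)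
      ⟨0, by simp⟩ (fun S S' h ⟨M, hM⟩ => ⟨M, fun u hu => hM u (h hu)⟩)
      (fun S S' ⟨M, hM⟩ ⟨M', hM'⟩ => ⟨max M M', fun u hu => hu.elim
        (fun h => (hM u h).trans (le_max_left _ _))
        (fun h => (hM' u h).trans (le_max_right _ _))⟩) ?_
    intro r hrR
    have hr0 : 0 ≤ r := hs.trans hrR.1
    obtain ⟨a, ha⟩ : ∃ a, ∀ᶠ u in 𝓝 r, r < u → ‖L u A‖ ≤ a := by
      obtain ⟨l, hl'⟩ := hr r hr0
      exact ⟨‖l A‖ + 1, eventually_nhdsWithin_iff.1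
        ((hl' A).norm.eventually_le_const (lt_add_one _))⟩
    obtain ⟨b, hb⟩ : ∃ b, ∀ᶠ u in 𝓝 r, u < r → s ≤ u → ‖L u A‖ ≤ b := by
      rcases hr0.eq_or_lt with h | h
      · refine ⟨0, Eventually.of_forall fun u h1 h2 => ?_⟩
        linarith
      · obtain ⟨l, hl'⟩ := hl r h
        refine ⟨‖l A‖ + 1, ?_⟩
        filter_upwards [eventually_nhdsWithin_iff.1
          ((hl' A).norm.eventually_le_const (lt_add_one _))] with u hu h1 _ using hu h1
    refine ⟨Icc s R ∩ {u | (r < u → ‖L u A‖ ≤ a) ∧ (u < r → s ≤ u → ‖L u A‖ ≤ b)},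
      inter_mem self_mem_nhdsWithin (mem_nhdsWithin_of_mem_nhds (ha.and hb)),
      max (max a b) ‖L r A‖, ?_⟩
    rintro u ⟨hu, h1, h2⟩
    rcases lt_trichotomy u r with h | h | h
    · exact (h2 h hu.1).trans ((le_max_right a b).trans (le_max_left _ _))
    · rw [h]; exact le_max_right _ _
    · exact (h1 h).trans ((le_max_left a b).trans (le_max_left _ _))
  obtain ⟨M, hM⟩ := banach_steinhaus
    (g := fun u : Icc s R => LinearMap.toContinuousLinearMap (L u)) (fun A => by
      obtain ⟨M, hM⟩ := hbdA A
      exact ⟨M, fun u => hM u u.2⟩)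
  exact ⟨M, fun u hu => hM ⟨u, hu⟩⟩

/-- Existence for the linear initial value problem with a piecewise continuous coefficient, on
operators of a finite-dimensional space. -/
theorem exists_linear_ivp_pointwise {V : Type*} [NormedAddCommGroup V] [NormedSpace ℂ V]
    [FiniteDimensional ℂ V] (L : ℝ → V →ₗ[ℂ] V)
    (hc : ∀ R : ℝ, ∃ F : Finset ℝ, ∀ A, ContinuousOn (fun r => L r A) (Icc 0 R \ F))
    (hr : ∀ r, 0 ≤ r → ∃ l : V →ₗ[ℂ] V, ∀ A, Tendsto (fun u => L u A) (𝓝[>] r) (𝓝 (l A)))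
    (hl : ∀ r, 0 < r → ∃ l : V →ₗ[ℂ] V, ∀ A, Tendsto (fun u => L u A) (𝓝[<] r) (𝓝 (l A))) :
    ∃ T : ℝ → ℝ → V →ₗ[ℂ] V, (∀ s, 0 ≤ s → T s s = 1) ∧
      (∀ s, 0 ≤ s → ∀ A, ContinuousOn (fun r => T r s A) (Ici s)) ∧
      ∀ s r, 0 ≤ s → s < r → (∀ A, ContinuousAt (fun u => L u A) r) →
        ∀ A, HasDerivAt (fun u => T u s A) (L r (T r s A)) r := by
  have : CompleteSpace V := FiniteDimensional.complete ℂ V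
  let Φ : ℝ → (V →L[ℂ] V) := fun r => LinearMap.toContinuousLinearMap (L r)
  have hΦ : ∀ r A, Φ r A = L r A := fun _ _ => rfl
  have hbd : ∀ s R, 0 ≤ s → ∃ M, ∀ u ∈ Icc s R, ‖Φ u‖ ≤ M :=
    bounded_of_oneSidedLimits L hr hl
  have hint : ∀ s R, 0 ≤ s → s ≤ R → IntervalIntegrable Φ volume s R := by
    intro s R hs hsR
    obtain ⟨M, hM⟩ := hbd s R hs
    obtain ⟨F, hF⟩ := hc R
    exact intervalIntegrable_of_bounded_of_continuousOn F hsR hM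
      ((continuousOn_clm_apply.2 hF).mono (sdiff_subset_sdiff_left (Icc_subset_Icc_left hs)))
  have hex : ∀ s, ∃ U : ℝ → (V →L[ℂ] V), 0 ≤ s →
      U s = 1 ∧ ContinuousOn U (Ici s) ∧
        ∀ r, s < r → ContinuousAt Φ r → HasDerivAt U (Φ r * U r) r := by
    intro s
    by_cases hs : 0 ≤ s
    · obtain ⟨U, hU⟩ := exists_linear_ivp Φ s (fun R hR => hint s R hs hR)
        (fun R _ => hbd s R hs)
      exact ⟨U, fun _ => hU⟩
    · exact ⟨fun _ => 1, fun h => absurd h hs⟩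
  choose U hU using hex
  refine ⟨fun r s => (U s r : V →ₗ[ℂ] V), ?_, ?_, ?_⟩
  · intro s hs
    dsimp only
    rw [(hU s hs).1]
    rfl
  · intro s hs A
    exact (hU s hs).2.1.clm_apply continuousOn_const
  · intro s r hs hr hcr A
    have hcr' : ContinuousAt Φ r := continuousAt_clm_apply.2 hcr
    have h1 := (hU s hs).2.2 r hr hcr'
    exact ((ContinuousLinearMap.apply ℂ V A).restrictScalars ℝ).hasFDerivAt.comp_hasDerivAt r h1

/-- Uniqueness for the linear initial value problem with a piecewise continuous coefficient. -/
theorem linear_ivp_zero {V : Type*} [NormedAddCommGroup V] [NormedSpace ℂ V]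
    [FiniteDimensional ℂ V] (L : ℝ → V →ₗ[ℂ] V)
    (hc : ∀ R : ℝ, ∃ F : Finset ℝ, ∀ A, ContinuousOn (fun r => L r A) (Icc 0 R \ F))
    (hr : ∀ r, 0 ≤ r → ∃ l : V →ₗ[ℂ] V, ∀ A, Tendsto (fun u => L u A) (𝓝[>] r) (𝓝 (l A)))
    (hl : ∀ r, 0 < r → ∃ l : V →ₗ[ℂ] V, ∀ A, Tendsto (fun u => L u A) (𝓝[<] r) (𝓝 (l A)))
    (D : ℝ → V) (s R : ℝ) (hs : 0 ≤ s) (hsR : s ≤ R) (h0 : D s = 0)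
    (hD : ContinuousOn D (Ici s))
    (hd : ∀ r, s < r → (∀ A, ContinuousAt (fun u => L u A) r) → HasDerivAt D (L r (D r)) r) :
    D R = 0 := by
  have : CompleteSpace V := FiniteDimensional.complete ℂ V
  let Φ : ℝ → (V →L[ℂ] V) := fun r => LinearMap.toContinuousLinearMap (L r)
  obtain ⟨M, hM⟩ : ∃ M, ∀ u ∈ Icc s R, ‖Φ u‖ ≤ M := bounded_of_oneSidedLimits L hr hl s R hs
  have hM0 : 0 ≤ M := (norm_nonneg _).trans (hM s ⟨le_rfl, hsR⟩)
  obtain ⟨F, hF⟩ := hc R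
  have hDc : ContinuousOn D (Icc s R) := hD.mono Icc_subset_Ici_self
  obtain ⟨C, hC⟩ := isCompact_Icc.exists_bound_of_continuousOn hDc
  have hΦ : ContinuousOn Φ (Icc s R \ F) :=
    (continuousOn_clm_apply.2 hF).mono (sdiff_subset_sdiff_left (Icc_subset_Icc_left hs))
  have hint : IntervalIntegrable (fun u => Φ u (D u)) volume s R :=
    intervalIntegrable_of_bounded_of_continuousOn (M := M * C) F hsR
      (fun u hu => (Φ u).le_of_opNorm_le_of_le (hM u hu) (hC u hu))
      (hΦ.clm_apply (hDc.mono sdiff_subset))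
  have hftc : ∀ r ∈ Icc s R, D r = ∫ u in s..r, Φ u (D u) := by
    intro r hrR
    have h := MeasureTheory.integral_eq_of_hasDerivAt_off_countable_of_le D
      (fun u => Φ u (D u)) hrR.1 F.countable_toSet (hDc.mono (Icc_subset_Icc_right hrR.2))
      (fun u hu => hd u hu.1.1 (fun A => (hF A).continuousAt (by
        rw [sdiff_eq]
        exact inter_mem (Icc_mem_nhds (hs.trans_lt hu.1.1) (hu.1.2.trans_le hrR.2))
          (F.finite_toSet.isClosed.isOpen_compl.mem_nhds hu.2))))
      (hint.mono_set (by
        rw [uIcc_of_le hrR.1, uIcc_of_le hsR]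
        exact Icc_subset_Icc_right hrR.2))
    rw [h, h0, sub_zero]
  have hn : ∀ n : ℕ, ∀ r ∈ Icc s R, ‖D r‖ ≤ C * ((M * (r - s)) ^ n / n.factorial) := by
    intro n
    induction n with
    | zero => intro r hr'; simpa using hC r hr'
    | succ n ih =>
      intro r hrR
      rw [hftc r hrR, ← integral_bound_step]
      refine intervalIntegral.norm_integral_le_of_norm_le hrR.1
        (Eventually.of_forall fun u hu => ?_) (Continuous.intervalIntegrable (by fun_prop) _ _)
      have hu' : u ∈ Icc s R := ⟨hu.1.le, hu.2.trans hrR.2⟩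
      exact (Φ u).le_of_opNorm_le_of_le (hM u hu') (ih u hu')
  have hlim : Tendsto (fun n : ℕ => C * ((M * (R - s)) ^ n / n.factorial)) atTop (𝓝 (C * 0)) :=
    (FloorSemiring.tendsto_pow_div_factorial_atTop _).const_mul C
  rw [mul_zero] at hlim
  exact norm_le_zero_iff.1 (ge_of_tendsto' hlim fun n => hn n R ⟨hsR, le_rfl⟩)

end VolterraSeries

section Operators

open scoped ComplexOrder

/-- Superoperators: linear maps on the operators of the Hilbert space with orthonormal basis
`ι`, operators being written as matrices. -/
abbrev SuperOp (ι : Type*) [Fintype ι] : Type _ :=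
  Matrix ι ι ℂ →ₗ[ℂ] Matrix ι ι ℂ

/-- The Schatten 1-norm `tr |A|`, the sum of the singular values of `A`, i.e. of the square roots
of the eigenvalues of `Aᴴ A`. -/
noncomputable def schattenOne {ι : Type*} [Fintype ι] [DecidableEq ι] (A : Matrix ι ι ℂ) : ℝ :=
  ∑ i, √((Matrix.isHermitian_conjTranspose_mul_self A).eigenvalues i)

/-- The induced norm `‖T‖_{1→1} = sup {‖T A‖₁ : ‖A‖₁ = 1}`. -/
noncomputable def oneNorm {ι : Type*} [Fintype ι] [DecidableEq ι] (T : SuperOp ι) : ℝ :=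
  sSup {x | ∃ A : Matrix ι ι ℂ, schattenOne A = 1 ∧ x = schattenOne (T A)}

/-- The ampliation `T ⊗ id_n` of a superoperator. -/
def ampliation {ι : Type*} [Fintype ι] (T : SuperOp ι) (n : ℕ)
    (A : Matrix (ι × Fin n) (ι × Fin n) ℂ) : Matrix (ι × Fin n) (ι × Fin n) ℂ :=
  fun p q => T (fun a b => A (a, p.2) (b, q.2)) p.1 q.1

/-- Quantum channels: completely positive trace-preserving maps. -/
def IsQuantumChannel {ι : Type*} [Fintype ι] (T : SuperOp ι) : Prop :=
  (∀ (n : ℕ) (A : Matrix (ι × Fin n) (ι × Fin n) ℂ),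
      A.PosSemidef → (ampliation T n A).PosSemidef) ∧
    ∀ A : Matrix ι ι ℂ, (T A).trace = A.trace

open Classical in
/-- The check function: `0` on quantum channels and `1` on all other superoperators. -/
noncomputable def Ch {ι : Type*} [Fintype ι] (T : SuperOp ι) : ℕ :=
  if IsQuantumChannel T then 0 else 1

/-- Piecewise continuity on `[0, ∞)`: finitely many discontinuities on every bounded interval, and
finite one-sided limits everywhere. Since the space of superoperators is finite dimensional,
its topology is that of pointwise convergence. -/
structure PiecewiseContinuous {ι : Type*} [Fintype ι] (L : ℝ → SuperOp ι) : Prop where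
  continuousOn : ∀ R : ℝ, ∃ F : Finset ℝ, ∀ A, ContinuousOn (fun r => L r A) (Icc 0 R \ F)
  rightLimit : ∀ r, 0 ≤ r → ∃ l : SuperOp ι, ∀ A, Tendsto (fun u => L u A) (𝓝[>] r) (𝓝 (l A))
  leftLimit : ∀ r, 0 < r → ∃ l : SuperOp ι, ∀ A, Tendsto (fun u => L u A) (𝓝[<] r) (𝓝 (l A))

/-- `T(·, s)` solves the initial value problem `∂ᵣ T(r, s) = L(r) T(r, s)`, `T(s, s) = 1`, on
`[s, ∞)` for every `s ≥ 0`. The equation is imposed wherever `L` is continuous; across the jumps of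
`L` the solution is continuous. -/
structure SolvesIVP {ι : Type*} [Fintype ι] (L : ℝ → SuperOp ι) (T : ℝ → ℝ → SuperOp ι) :
    Prop where
  initial : ∀ s, 0 ≤ s → T s s = 1
  continuousOn : ∀ s, 0 ≤ s → ∀ A, ContinuousOn (fun r => T r s A) (Ici s)
  hasDerivAt : ∀ s r, 0 ≤ s → s < r → (∀ A, ContinuousAt (fun u => L u A) r) →
    ∀ A, HasDerivAt (fun u => T u s A) (L r (T r s A)) r

/-- The propagators `T_L(r, s)`: the solution of the initial value problem (determined for
`r ≥ s ≥ 0`). -/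
noncomputable def propagator {ι : Type*} [Fintype ι] (L : ℝ → SuperOp ι) : ℝ → ℝ → SuperOp ι :=
  Classical.epsilon (SolvesIVP L)

section ExistenceUniqueness

attribute [local instance] Matrix.normedAddCommGroup Matrix.normedSpace

theorem exists_solvesIVP {ι : Type*} [Fintype ι] {L : ℝ → SuperOp ι}
    (hL : PiecewiseContinuous L) : ∃ T, SolvesIVP L T := by
  obtain ⟨T, h1, h2, h3⟩ :=
    exists_linear_ivp_pointwise L hL.continuousOn hL.rightLimit hL.leftLimit
  exact ⟨T, h1, h2, h3⟩

/-- The propagators are uniquely determined for `r ≥ s ≥ 0`. -/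
theorem SolvesIVP.unique {ι : Type*} [Fintype ι] {L : ℝ → SuperOp ι}
    (hL : PiecewiseContinuous L) {T T' : ℝ → ℝ → SuperOp ι} (hT : SolvesIVP L T)
    (hT' : SolvesIVP L T') {s r : ℝ} (hs : 0 ≤ s) (hsr : s ≤ r) : T r s = T' r s := by
  refine LinearMap.ext fun A => sub_eq_zero.1 ?_
  refine linear_ivp_zero L hL.continuousOn hL.rightLimit hL.leftLimit
    (fun u => T u s A - T' u s A) s r hs hsr ?_ ?_ ?_
  · simp [hT.initial s hs, hT'.initial s hs]
  · exact (hT.continuousOn s hs A).sub (hT'.continuousOn s hs A)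
  · intro u hu hc
    rw [map_sub]
    exact (hT.hasDerivAt s u hs hu hc A).sub (hT'.hasDerivAt s u hs hu hc A)

end ExistenceUniqueness

theorem propagator_solvesIVP {ι : Type*} [Fintype ι] {L : ℝ → SuperOp ι}
    (hL : PiecewiseContinuous L) : SolvesIVP L (propagator L) :=
  Classical.epsilon_spec (exists_solvesIVP hL)

end Operators

section Systems

/-- The superoperator `T` on `⨂_{x ∈ Λ} ℂ^d` acts non-trivially at most on `Z`: it is of the
form `T = S ⊗ id` with a superoperator `S` on `⨂_{x ∈ Z} ℂ^d`. -/
def ActsOn {Λ : Type*} [Fintype Λ] [DecidableEq Λ] {d : ℕ} (Z : Finset Λ)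
    (T : SuperOp (Λ → Fin d)) : Prop :=
  ∃ S : SuperOp (Z → Fin d), ∀ (A : Matrix (Λ → Fin d) (Λ → Fin d) ℂ) (σ τ : Λ → Fin d),
    T A σ τ = S (fun a b => A (fun x => if h : x ∈ Z then a ⟨x, h⟩ else σ x)
      (fun x => if h : x ∈ Z then b ⟨x, h⟩ else τ x)) (fun x => σ x) (fun x => τ x)

/-- A `k`-local open many-body system on the lattice `Λ` with local dimension `d`: a time-local
Liouvillian given as a sum of `K` piecewise continuous strictly `k`-local terms. -/
structure LocalSystem (Λ : Type*) [Fintype Λ] [DecidableEq Λ] (d k K : ℕ) where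
  region : Fin K → Finset Λ
  card_region_le : ∀ i, (region i).card ≤ k
  term : Fin K → ℝ → SuperOp (Λ → Fin d)
  actsOn : ∀ i r, 0 ≤ r → ActsOn (region i) (term i r)
  piecewiseContinuous : ∀ i, PiecewiseContinuous (term i)

namespace LocalSystem

variable {Λ : Type*} [Fintype Λ] [DecidableEq Λ] {d k K : ℕ} (S : LocalSystem Λ d k K)

/-- The full Liouvillian `∑ᵢ Lᵢ`. -/
def liouvillian (r : ℝ) : SuperOp (Λ → Fin d) := ∑ i, S.term i r

theorem piecewiseContinuous_liouvillian : PiecewiseContinuous S.liouvillian where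
  continuousOn R := by
    choose F hF using fun i => (S.piecewiseContinuous i).continuousOn R
    refine ⟨Finset.univ.biUnion F, fun A => ?_⟩
    simp only [liouvillian, LinearMap.sum_apply]
    refine continuousOn_finsetSum _ fun i _ => (hF i A).mono (sdiff_subset_sdiff_right ?_)
    exact_mod_cast Finset.subset_biUnion_of_mem F (Finset.mem_univ i)
  rightLimit r hr := by
    choose l hl using fun i => (S.piecewiseContinuous i).rightLimit r hr
    refine ⟨∑ i, l i, fun A => ?_⟩
    simp only [liouvillian, LinearMap.sum_apply]
    exact tendsto_finsetSum _ fun i _ => hl i A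
  leftLimit r hr := by
    choose l hl using fun i => (S.piecewiseContinuous i).leftLimit r hr
    refine ⟨∑ i, l i, fun A => ?_⟩
    simp only [liouvillian, LinearMap.sum_apply]
    exact tendsto_finsetSum _ fun i _ => hl i A

/-- The local propagator of the `i`-th term over the `j`-th of `m` equal subintervals of `[0, t]`;
here `j` runs from `0`, so that the subinterval is `[t j / m, t (j + 1) / m]`. -/
noncomputable def step (t : ℝ) (m : ℕ) (i : Fin K) (j : ℕ) : SuperOp (Λ → Fin d) :=
  propagator (S.term i) (t * (j + 1) / m) (t * j / m)

/-- The first order decomposition with `m` steps: the product over `j` and, inside, over `i`;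
in both products later factors stand on the left. -/
noncomputable def trotter (t : ℝ) (m : ℕ) : SuperOp (Λ → Fin d) :=
  (List.ofFn fun j : Fin m => (List.ofFn fun i : Fin K => S.step t m i j).reverse.prod).reverse.prod

/-- The decomposition error in the `1 → 1` norm. -/
noncomputable def trotterError (t : ℝ) (m : ℕ) : ℝ :=
  oneNorm (propagator S.liouvillian t 0 - S.trotter t m)

/-- The number of subintervals on which the `i`-th local propagator is not a channel. -/
noncomputable def numIndivisible (t : ℝ) (m : ℕ) (i : Fin K) : ℕ :=
  ∑ j ∈ Finset.range m, Ch (S.step t m i j)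

open Classical in
/-- The number of pairs of neighbouring subintervals such that the `i`-th local propagator is a
channel on the first and not a channel on the second. -/
noncomputable def numTransitions (t : ℝ) (m : ℕ) (i : Fin K) : ℕ :=
  ∑ j ∈ Finset.range (m - 1),
    if Ch (S.step t m i j) = 0 ∧ Ch (S.step t m i (j + 1)) = 1 then 1 else 0

/-- `tID i = lim_m N_i^m t / m`. -/
def IsIndivisibleTimes (t : ℝ) (tID : Fin K → ℝ) : Prop :=
  ∀ i, Tendsto (fun m : ℕ => (S.numIndivisible t m i : ℝ) * t / m) atTop (𝓝 (tID i))

/-- `C i = lim_m C_i^m`. -/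
def IsTransitionNumbers (t : ℝ) (C : Fin K → ℝ) : Prop :=
  ∀ i, Tendsto (fun m : ℕ => (S.numTransitions t m i : ℝ)) atTop (𝓝 (C i))

/-- `β = sup_{0 ≤ r ≤ t} max_i ‖L_i(r)‖_{1→1}`. -/
noncomputable def beta (t : ℝ) : ℝ :=
  sSup {x | ∃ r ∈ Icc 0 t, ∃ i, x = oneNorm (S.term i r)}

/-- Local divisibility up to time `t`: all local propagators within `[0, t]` are channels. -/
def LocallyDivisible (t : ℝ) : Prop :=
  ∀ i s r, 0 ≤ s → s ≤ r → r ≤ t → IsQuantumChannel (propagator (S.term i) r s)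

end LocalSystem

end Systems

/-! ### The trace norm through positive semidefinite block matrices. -/

section TraceNorm

open Matrix
open scoped ComplexOrder

/-! The error of a product formula is consistency times stability. On a cell of length τ both the
full propagator and the ordered product of the local ones equal `1 + ∑ᵢ ∫ Lᵢ` up to `K²β²τ²` times a
growth factor (`norm_sub_prod_le`). Telescoping over m cells with τ = t/m (`norm_sub_trotter_le`)
gives `2K²β²t²/m` times the growth factor over [0, t].

Stability is where divisibility enters. A channel contracts the trace norm, and any other local
propagator over a cell of length t/n grows by at most `exp (β t/n)` (Grönwall). On the n-th grid the
i-th local evolution therefore grows at most like the exponential of β times the total length of its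
non-channel cells. Letting n → ∞ (`IsEvolution.exists_growth`) produces a monotone function gᵢ with
`‖Tᵢ(r,s)‖ ≤ exp (gᵢ r - gᵢ s)` for all s ≤ r and total increment at most β tᵢᴵᴰ. This grid is
independent of the m steps of the product formula, so the bound holds for every m ≥ 1.

The full propagator needs the same control, although only the local propagators are tested for being
channels. It is obtained by bootstrapping (`norm_le_exp_sum`): the product formula, with the crude
growth rate β, already shows that the full propagator is a limit of products of local ones, and
these grow at most by `exp (∑ᵢ (gᵢ r - gᵢ s))`. The resulting rate `β ∑ᵢ tᵢᴵᴰ` (`trotterError_le`)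
is at most `(K + K²) tᴵᴰ β`, and it vanishes in the locally divisible case.

Contractivity of channels, like the triangle inequality, follows from a description of ‖A‖₁ as the
minimum of (tr X + tr Y)/2 over positive semidefinite blocks with diagonal X, Y and off-diagonal A,
Aᴴ: complete positivity with a two-dimensional ancilla preserves such blocks. -/

theorem Matrix.PosSemidef.fromBlocks_conjTranspose {ι : Type*} {X A A' Y : Matrix ι ι ℂ}
    (h : (fromBlocks X A A' Y).PosSemidef) : A' = Aᴴ :=
  (isHermitian_fromBlocks_iff.1 h.1).2.1.symm

variable {ι : Type*} [Fintype ι] [DecidableEq ι]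

theorem schattenOne_nonneg (A : Matrix ι ι ℂ) : 0 ≤ schattenOne A :=
  Finset.sum_nonneg fun _ _ => Real.sqrt_nonneg _

/-- Singular value decomposition: with `V` unitary, the columns of `A * V` are orthogonal and their
norms are the singular values. -/
theorem exists_singularValues (A : Matrix ι ι ℂ) :
    ∃ (V : Matrix ι ι ℂ) (σ : ι → ℝ), V * Vᴴ = 1 ∧ Vᴴ * V = 1 ∧ (∀ i, 0 ≤ σ i) ∧
      (A * V)ᴴ * (A * V) = diagonal (fun i => (σ i : ℂ) ^ 2) ∧ schattenOne A = ∑ i, σ i := by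
  have hA := isHermitian_conjTranspose_mul_self A
  set V : Matrix ι ι ℂ := hA.eigenvectorUnitary.1
  have h1 : V * Vᴴ = 1 := Unitary.coe_mul_star_self hA.eigenvectorUnitary
  have h2 : Vᴴ * V = 1 := Unitary.coe_star_mul_self hA.eigenvectorUnitary
  refine ⟨V, fun i => √(hA.eigenvalues i), h1, h2, fun i => Real.sqrt_nonneg _, ?_, rfl⟩
  have h3 : Aᴴ * A = V * diagonal (fun i => (hA.eigenvalues i : ℂ)) * Vᴴ := by
    have := hA.spectral_theorem
    rw [Unitary.conjStarAlgAut_apply] at this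
    exact this
  have h4 : (A * V)ᴴ * (A * V) = diagonal (fun i => (hA.eigenvalues i : ℂ)) := by
    calc (A * V)ᴴ * (A * V) = Vᴴ * (Aᴴ * A) * V := by
          rw [conjTranspose_mul]; simp only [Matrix.mul_assoc]
      _ = (Vᴴ * V) * diagonal (fun i => (hA.eigenvalues i : ℂ)) * (Vᴴ * V) := by
          rw [congrArg (fun M => Vᴴ * M * V) h3]; simp only [Matrix.mul_assoc]
      _ = _ := by rw [h2, Matrix.one_mul, Matrix.mul_one]
  rw [h4]
  congr 1
  ext i
  have h5 : 0 ≤ hA.eigenvalues i :=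
    (posSemidef_conjTranspose_mul_self A).eigenvalues_nonneg i
  rw [← Complex.ofReal_pow, Real.sq_sqrt h5]

/-- Let C be the partial isometry with `Cᴴ A V = diag σ`. Compressing the block by the column `(-C;
V)` gives `tr (Cᴴ X C) - 2 ∑ σ + tr (Vᴴ Y V) ≥ 0`; the first trace is at most tr X since `C Cᴴ` is a
projection, the last is tr Y since V is unitary. -/
theorem schattenOne_le_of_posSemidef_fromBlocks {X A A' Y : Matrix ι ι ℂ}
    (h : (fromBlocks X A A' Y).PosSemidef) :
    schattenOne A ≤ (X.trace.re + Y.trace.re) / 2 := by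
  have hA' := h.fromBlocks_conjTranspose
  subst hA'
  obtain ⟨V, σ, hV1, hV2, hσ, hAV, hsum⟩ := exists_singularValues A
  -- Since `0⁻¹ = 0`, this is the pseudoinverse of `diag σ`, and C is only a partial isometry
  -- (`hCC`).
  set D : Matrix ι ι ℂ := diagonal (fun i => ((σ i)⁻¹ : ℂ)) with hD
  set C : Matrix ι ι ℂ := A * V * D with hC
  have hDH : Dᴴ = D := by
    rw [hD, diagonal_conjTranspose]
    congr 1
    ext i
    simp
  have hCAV : Cᴴ * A * V = diagonal (fun i => (σ i : ℂ)) := by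
    rw [hC, conjTranspose_mul, hDH, Matrix.mul_assoc, Matrix.mul_assoc, hAV, hD,
      diagonal_mul_diagonal]
    congr 1
    ext i
    by_cases hi : (σ i : ℂ) = 0
    · simp [hi]
    · field_simp
  have hCC : C * (Cᴴ * C) = C := by
    have h1 : Cᴴ * C = diagonal (fun i => (σ i : ℂ) * (σ i : ℂ)⁻¹) := by
      rw [← Matrix.diagonal_mul_diagonal, ← hCAV, hC]
      simp only [Matrix.mul_assoc]
      rfl
    rw [h1, hC, Matrix.mul_assoc, hD, diagonal_mul_diagonal]
    congr 2
    ext i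
    by_cases hi : (σ i : ℂ) = 0
    · simp [hi]
    · field_simp
  have hX : X.PosSemidef := h.submatrix Sum.inl
  -- The difference of the two traces is the trace of X compressed by the complementary projection
  -- `1 - C Cᴴ`.
  have h1 : (Cᴴ * X * C).trace.re ≤ X.trace.re := by
    have h2 := (hX.conjTranspose_mul_mul_same (1 - C * Cᴴ)).trace_nonneg
    have h3 : ((1 - C * Cᴴ)ᴴ * X * (1 - C * Cᴴ)).trace = X.trace - (Cᴴ * X * C).trace := by
      have e1 : (1 - C * Cᴴ) * (1 - C * Cᴴ)ᴴ = 1 - C * Cᴴ := by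
        rw [conjTranspose_sub, conjTranspose_mul C, conjTranspose_one, conjTranspose_conjTranspose]
        have : C * Cᴴ * (C * Cᴴ) = C * Cᴴ := by
          rw [← Matrix.mul_assoc, Matrix.mul_assoc C, hCC]
        rw [Matrix.sub_mul, Matrix.one_mul, Matrix.mul_sub, Matrix.mul_one, this]
        simp
      rw [trace_mul_cycle, e1, Matrix.sub_mul, Matrix.one_mul, trace_sub, Matrix.mul_assoc C,
        trace_mul_comm C]
    rw [h3] at h2
    have := (Complex.le_def.1 h2).1
    simp only [Complex.zero_re, Complex.sub_re] at this
    linarith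
  have h2 : (Vᴴ * Y * V).trace = Y.trace := by
    rw [trace_mul_cycle, hV1, Matrix.one_mul]
  have h3 := (h.conjTranspose_mul_mul_same (fromRows (-C) V)).trace_nonneg
  have h4 : (fromRows (-C) V)ᴴ * fromBlocks X A Aᴴ Y * fromRows (-C) V =
      Cᴴ * X * C - Cᴴ * A * V - (Cᴴ * A * V)ᴴ + Vᴴ * Y * V := by
    rw [conjTranspose_fromRows_eq_fromCols_conjTranspose, Matrix.mul_assoc,
      fromBlocks_mul_fromRows, fromCols_mul_fromRows]
    simp only [conjTranspose_neg, conjTranspose_mul, conjTranspose_conjTranspose, Matrix.mul_add,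
      Matrix.mul_neg, Matrix.neg_mul, Matrix.mul_assoc]
    abel
  rw [h4, hCAV] at h3
  have h5 := (Complex.le_def.1 h3).1
  simp only [trace_add, trace_sub, h2, trace_conjTranspose, trace_diagonal, Complex.add_re,
    Complex.sub_re, Complex.zero_re, Complex.re_sum, Complex.ofReal_re, star_sum, Complex.star_def,
    Complex.conj_ofReal] at h5
  rw [hsum]
  linarith

/-- The minimum is attained: with B = A V, the block is `W Wᴴ` for the column `W = (B σ^(-1/2); V
σ^(1/2))`. Its off-diagonal entry is `B Vᴴ = A`, and both diagonal traces equal ∑ σ. -/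
theorem exists_posSemidef_fromBlocks (A : Matrix ι ι ℂ) :
    ∃ X Y : Matrix ι ι ℂ, (fromBlocks X A Aᴴ Y).PosSemidef ∧
      X.trace.re = schattenOne A ∧ Y.trace.re = schattenOne A := by
  obtain ⟨V, σ, hV1, hV2, hσ, hAV, hsum⟩ := exists_singularValues A
  set B := A * V with hB
  set s : ι → ℝ := fun i => √(σ i) with hs
  have hss : ∀ i, s i * s i = σ i := fun i => Real.mul_self_sqrt (hσ i)
  set D : Matrix ι ι ℂ := diagonal (fun i => ((s i)⁻¹ : ℂ)) with hD
  set F : Matrix ι ι ℂ := diagonal (fun i => (s i : ℂ)) with hF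
  have hDH : Dᴴ = D := by
    rw [hD, diagonal_conjTranspose]
    congr 1
    ext i
    simp
  have hFH : Fᴴ = F := by
    rw [hF, diagonal_conjTranspose]
    congr 1
    ext i
    simp
  -- `D F` is the projection onto the nonzero singular values; the columns of B that it kills have
  -- norm zero, as the Gram matrix of `B (1 - D F)` shows.
  have hBDF : B * (D * F) = B := by
    have : (B * (1 - D * F))ᴴ * (B * (1 - D * F)) = 0 := by
      rw [conjTranspose_mul, Matrix.mul_assoc, ← Matrix.mul_assoc Bᴴ, hAV, hD, hF,
        diagonal_mul_diagonal, ← diagonal_one, diagonal_sub, diagonal_conjTranspose,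
        diagonal_mul_diagonal, diagonal_mul_diagonal, diagonal_eq_zero]
      ext i
      have := hss i
      by_cases hi : s i = 0
      · rw [hi] at this
        simp [← this]
      · have hi' : (s i : ℂ) ≠ 0 := by exact_mod_cast hi
        simp [hi']
    have := conjTranspose_mul_self_eq_zero.1 this
    rw [Matrix.mul_sub, Matrix.mul_one, sub_eq_zero] at this
    exact this.symm
  have hBVA : B * Vᴴ = A := by rw [hB, Matrix.mul_assoc, hV1, Matrix.mul_one]
  have key : fromRows (B * D) (V * F) * (fromRows (B * D) (V * F))ᴴ =
      fromBlocks (B * D * (B * D)ᴴ) A Aᴴ (V * F * (V * F)ᴴ) := by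
    have h1 : B * D * (V * F)ᴴ = A := by
      rw [conjTranspose_mul, hFH, Matrix.mul_assoc, ← Matrix.mul_assoc D, ← Matrix.mul_assoc B,
        hBDF, hBVA]
    have h2 : V * F * (B * D)ᴴ = Aᴴ := by
      rw [← h1, conjTranspose_mul (B * D), conjTranspose_conjTranspose]
    rw [conjTranspose_fromRows_eq_fromCols_conjTranspose, fromRows_mul_fromCols, h1, h2]
  refine ⟨_, _, key ▸ posSemidef_self_mul_conjTranspose _, ?_, ?_⟩
  · rw [trace_mul_comm, conjTranspose_mul, hDH, Matrix.mul_assoc, ← Matrix.mul_assoc Bᴴ, hAV, hD,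
      diagonal_mul_diagonal, diagonal_mul_diagonal, trace_diagonal, Complex.re_sum, hsum]
    refine Finset.sum_congr rfl fun i _ => ?_
    have := hss i
    rw [← this]
    by_cases hi : s i = 0
    · simp [hi]
    · have hi' : (s i : ℂ) ≠ 0 := by exact_mod_cast hi
      push_cast
      field_simp
      norm_cast
  · rw [trace_mul_comm, conjTranspose_mul, hFH, Matrix.mul_assoc, ← Matrix.mul_assoc Vᴴ, hV2,
      Matrix.one_mul, hF, diagonal_mul_diagonal, trace_diagonal, Complex.re_sum, hsum]
    refine Finset.sum_congr rfl fun i _ => ?_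
    rw [← hss i]
    norm_cast

/-- Optimal blocks for A and B add up to an admissible block for A + B. -/
theorem schattenOne_add_le (A B : Matrix ι ι ℂ) :
    schattenOne (A + B) ≤ schattenOne A + schattenOne B := by
  obtain ⟨X, Y, h, hX, hY⟩ := exists_posSemidef_fromBlocks A
  obtain ⟨X', Y', h', hX', hY'⟩ := exists_posSemidef_fromBlocks B
  have h2 := h.add h'
  rw [fromBlocks_add] at h2
  refine (schattenOne_le_of_posSemidef_fromBlocks h2).trans (le_of_eq ?_)
  simp only [trace_add, Complex.add_re, hX, hY, hX', hY']
  ring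

/-- One inequality suffices, since the other is the same one for c⁻¹ and c • A. -/
theorem schattenOne_smul (c : ℂ) (A : Matrix ι ι ℂ) :
    schattenOne (c • A) = ‖c‖ * schattenOne A := by
  have key : ∀ (c : ℂ) (A : Matrix ι ι ℂ), schattenOne (c • A) ≤ ‖c‖ * schattenOne A := by
    intro c A
    rcases eq_or_ne c 0 with rfl | hc
    · have h0 : (fromBlocks (0 : Matrix ι ι ℂ) 0 0 0 : Matrix (ι ⊕ ι) (ι ⊕ ι) ℂ).PosSemidef := by
        rw [fromBlocks_zero]
        exact PosSemidef.zero
      simpa using schattenOne_le_of_posSemidef_fromBlocks h0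
    obtain ⟨X, Y, h, hX, hY⟩ := exists_posSemidef_fromBlocks A
    have hn : (0 : ℝ) < ‖c‖ := norm_pos_iff.2 hc
    have h3 : (fromBlocks ((‖c‖ : ℂ) • X) (c • A) (star c • Aᴴ) ((‖c‖ : ℂ) • Y)).PosSemidef := by
      set b : ℂ := ((√‖c‖ : ℝ) : ℂ) with hb
      have hb0 : b ≠ 0 := by
        rw [hb]
        exact_mod_cast (Real.sqrt_pos.2 hn).ne'
      have hbs : star b = b := by simp [hb]
      have hbb : b * b = ‖c‖ := by
        rw [hb]
        exact_mod_cast Real.mul_self_sqrt hn.le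
      have hcc : c * star c = b * b * (b * b) := by
        rw [hbb, Complex.star_def, Complex.mul_conj, Complex.normSq_eq_norm_sq]
        push_cast
        ring
      -- With b = √‖c‖, this congruence multiplies both diagonal entries by ‖c‖ and the off-diagonal
      -- ones by c and its conjugate.
      have h4 := h.conjTranspose_mul_mul_same
        (fromBlocks ((star c / b) • (1 : Matrix ι ι ℂ)) 0 0 (b • (1 : Matrix ι ι ℂ)))
      rw [fromBlocks_conjTranspose, fromBlocks_multiply, fromBlocks_multiply] at h4
      simp only [conjTranspose_smul, conjTranspose_one, conjTranspose_zero, Matrix.zero_mul,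
        Matrix.mul_zero, add_zero, zero_add, Matrix.one_mul, Matrix.mul_one, Matrix.smul_mul,
        Matrix.mul_smul, star_div₀, star_star, smul_smul, hbs] at h4
      have e1 : star c / b * (c / b) = b * b := by
        field_simp
        rw [mul_comm, hcc]
        ring
      have e2 : b * (c / b) = c := by field_simp
      have e3 : star c / b * b = star c := by field_simp
      rwa [e1, e2, e3, hbb] at h4
    refine (schattenOne_le_of_posSemidef_fromBlocks h3).trans (le_of_eq ?_)
    simp only [trace_smul, smul_eq_mul, Complex.re_ofReal_mul, hX, hY]
    ring
  refine le_antisymm (key c A) ?_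
  rcases eq_or_ne c 0 with rfl | hc
  · simpa using schattenOne_nonneg _
  · have h := key c⁻¹ (c • A)
    rw [smul_smul, inv_mul_cancel₀ hc, one_smul, norm_inv] at h
    have hn : (0 : ℝ) < ‖c‖ := norm_pos_iff.2 hc
    rwa [inv_mul_eq_div, le_div_iff₀ hn, mul_comm] at h

theorem schattenOne_eq_zero_iff (A : Matrix ι ι ℂ) : schattenOne A = 0 ↔ A = 0 := by
  constructor
  · intro h
    obtain ⟨V, σ, hV1, hV2, hσ, hAV, hsum⟩ := exists_singularValues A
    rw [hsum, Finset.sum_eq_zero_iff_of_nonneg fun i _ => hσ i] at h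
    have h0 : (A * V)ᴴ * (A * V) = 0 := by
      rw [hAV, diagonal_eq_zero]
      ext i
      simp [h i (Finset.mem_univ i)]
    have h1 := conjTranspose_mul_self_eq_zero.1 h0
    calc A = A * V * Vᴴ := by rw [Matrix.mul_assoc, hV1, Matrix.mul_one]
      _ = 0 := by rw [h1, Matrix.zero_mul]
  · rintro rfl
    simpa using schattenOne_smul (0 : ℂ) (0 : Matrix ι ι ℂ)

/-- Quantum channels are contractions for the trace norm. -/
theorem IsQuantumChannel.schattenOne_le {T : SuperOp ι} (hT : IsQuantumChannel T)
    (A : Matrix ι ι ℂ) : schattenOne (T A) ≤ schattenOne A := by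
  obtain ⟨X, Y, h, hX, hY⟩ := exists_posSemidef_fromBlocks A
  -- Block indices are identified with ι × Fin 2, so that `T ⊗ id₂` acts on a 2 × 2 block matrix
  -- entry by entry.
  let f : ι × Fin 2 → ι ⊕ ι := fun p => if p.2 = 0 then Sum.inl p.1 else Sum.inr p.1
  let g : ι ⊕ ι → ι × Fin 2 := Sum.elim (fun i => (i, 0)) (fun i => (i, 1))
  have h1 := (hT.1 2 _ (h.submatrix f)).submatrix g
  have h2 : (ampliation T 2 ((fromBlocks X A Aᴴ Y).submatrix f f)).submatrix g g =
      fromBlocks (T X) (T A) (T Aᴴ) (T Y) := by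
    ext (i | i) (j | j) <;> rfl
  rw [h2] at h1
  refine (schattenOne_le_of_posSemidef_fromBlocks h1).trans (le_of_eq ?_)
  rw [hT.2, hT.2, hX, hY]
  ring

end TraceNorm

/-! ### Grönwall's inequality in integral form. -/

section Gronwall

theorem integral_mul_exp (β c a r : ℝ) :
    ∫ u in a..r, β * (c * Real.exp (β * (u - a))) = c * Real.exp (β * (r - a)) - c := by
  have h : ∀ u ∈ uIcc a r, HasDerivAt (fun u => c * Real.exp (β * (u - a)))
      (β * (c * Real.exp (β * (u - a)))) u := by
    intro u _
    have h1 : HasDerivAt (fun u : ℝ => β * (u - a)) β u := by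
      simpa using ((hasDerivAt_id u).sub_const a).const_mul β
    exact (h1.exp.const_mul c).congr_deriv (by ring)
  rw [intervalIntegral.integral_eq_sub_of_hasDerivAt h
    (Continuous.intervalIntegrable (by fun_prop) _ _)]
  simp

/-- Grönwall's inequality for a linear Volterra equation. -/
theorem norm_le_of_eq_add_integral {E : Type*} [NormedRing E] [NormedAlgebra ℝ E]
    {Φ D : ℝ → E} {c : E} {a b β : ℝ}
    (hΦ : ∀ u ∈ Icc a b, ‖Φ u‖ ≤ β) (hD : ContinuousOn D (Icc a b))
    (heq : ∀ r ∈ Icc a b, D r = c + ∫ u in a..r, Φ u * D u) {r : ℝ} (hr : r ∈ Icc a b) :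
    ‖D r‖ ≤ ‖c‖ * Real.exp (β * (r - a)) := by
  obtain ⟨C, hC⟩ := isCompact_Icc.exists_bound_of_continuousOn hD
  have hβ : 0 ≤ β := (norm_nonneg _).trans (hΦ r hr)
  -- Iterating the equation reproduces the exponential exactly and turns the crude bound C into a
  -- Taylor term, which tends to 0.
  have hn : ∀ n : ℕ, ∀ r ∈ Icc a b, ‖D r‖ ≤
      ‖c‖ * Real.exp (β * (r - a)) + C * ((β * (r - a)) ^ n / n.factorial) := by
    intro n
    induction n with
    | zero =>
      intro r hr
      have := hC r hr
      have : 0 ≤ ‖c‖ * Real.exp (β * (r - a)) := by positivity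
      simp only [pow_zero, Nat.factorial_zero, Nat.cast_one, div_one, mul_one]
      linarith
    | succ n ih =>
      intro r hr
      have h1 : ‖∫ u in a..r, Φ u * D u‖ ≤ ∫ u in a..r, (β * (‖c‖ * Real.exp (β * (u - a))) +
          β * (C * ((β * (u - a)) ^ n / n.factorial))) := by
        refine intervalIntegral.norm_integral_le_of_norm_le hr.1
          (Eventually.of_forall fun u hu => ?_) (Continuous.intervalIntegrable (by fun_prop) _ _)
        have hu' : u ∈ Icc a b := ⟨hu.1.le, hu.2.trans hr.2⟩
        rw [← mul_add]
        exact (norm_mul_le _ _).trans (mul_le_mul (hΦ u hu') (ih u hu') (norm_nonneg _) hβ)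
      rw [intervalIntegral.integral_add (Continuous.intervalIntegrable (by fun_prop) _ _)
        (Continuous.intervalIntegrable (by fun_prop) _ _), integral_mul_exp,
        integral_bound_step] at h1
      rw [heq r hr]
      refine (norm_add_le _ _).trans ?_
      linarith
  have hlim : Tendsto (fun n : ℕ => ‖c‖ * Real.exp (β * (r - a)) +
      C * ((β * (r - a)) ^ n / n.factorial)) atTop
      (𝓝 (‖c‖ * Real.exp (β * (r - a)) + C * 0)) :=
    ((FloorSemiring.tendsto_pow_div_factorial_atTop _).const_mul C).const_add _
  rw [mul_zero, add_zero] at hlim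
  exact ge_of_tendsto' hlim fun n => hn n r hr

end Gronwall

/-! ### Product formulas for evolutions in a normed algebra. -/

section Evolution

/-- Only `‖1‖ ≤ 1` is required, because `1 = 0` in the operator algebra when the index type is empty
(d = 0 on a nonempty lattice). -/
theorem norm_reverse_prod_ofFn_le {E : Type*} [NormedRing E] (h1 : ‖(1 : E)‖ ≤ 1) {n : ℕ} (f : Fin n → E) (γ : Fin n → ℝ)
    (hf : ∀ i, ‖f i‖ ≤ Real.exp (γ i)) :
    ‖(List.ofFn f).reverse.prod‖ ≤ Real.exp (∑ i, γ i) := by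
  induction n with
  | zero => simpa using h1
  | succ n ih =>
    rw [List.ofFn_succ', List.concat_eq_append, List.reverse_append, List.reverse_singleton,
      List.singleton_append, List.prod_cons, Fin.sum_univ_castSucc, add_comm, Real.exp_add]
    exact (norm_mul_le _ _).trans (mul_le_mul (hf _) (ih _ _ fun i => hf _) (norm_nonneg _)
      (Real.exp_pos _).le)

variable {E : Type*} [NormedRing E] [NormedAlgebra ℝ E]

/-- `U` solves the linear Volterra equation with bounded coefficient `Φ` on `[0, t]`. -/
structure IsEvolution (Φ : ℝ → E) (U : ℝ → ℝ → E) (t β : ℝ) : Prop where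
  norm_le : ∀ u ∈ Icc 0 t, ‖Φ u‖ ≤ β
  intervalIntegrable : ∀ s r, 0 ≤ s → s ≤ r → r ≤ t → IntervalIntegrable Φ volume s r
  continuousOn : ∀ s, 0 ≤ s → ContinuousOn (fun r => U r s) (Icc s t)
  eq_add_integral : ∀ s r, 0 ≤ s → s ≤ r → r ≤ t → U r s = 1 + ∫ u in s..r, Φ u * U u s

namespace IsEvolution

variable {Φ : ℝ → E} {U : ℝ → ℝ → E} {t β : ℝ}

theorem self (h : IsEvolution Φ U t β) {s : ℝ} (hs : 0 ≤ s) (hst : s ≤ t) : U s s = 1 := by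
  rw [h.eq_add_integral s s hs le_rfl hst]
  simp

theorem intervalIntegrable_mul (h : IsEvolution Φ U t β) {s u r : ℝ} (hs : 0 ≤ s) (hsu : s ≤ u)
    (hur : u ≤ r) (hrt : r ≤ t) : IntervalIntegrable (fun v => Φ v * U v s) volume u r :=
  (h.intervalIntegrable u r (hs.trans hsu) hur hrt).mul_continuousOn (by
    rw [uIcc_of_le hur]
    exact (h.continuousOn s hs).mono (Icc_subset_Icc hsu hrt))

theorem norm_le_exp (h : IsEvolution Φ U t β) (h1 : ‖(1 : E)‖ ≤ 1) {s r : ℝ} (hs : 0 ≤ s)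
    (hsr : s ≤ r) (hrt : r ≤ t) : ‖U r s‖ ≤ Real.exp (β * (r - s)) := by
  refine (norm_le_of_eq_add_integral (b := t) (c := 1)
    (fun u hu => h.norm_le u ⟨hs.trans hu.1, hu.2⟩) (h.continuousOn s hs)
    (fun r hr => h.eq_add_integral s r hs hr.1 hr.2) ⟨hsr, hrt⟩).trans ?_
  exact mul_le_of_le_one_left (Real.exp_pos _).le h1

/-- As a function of the final time, the difference of the two sides solves the Volterra equation
with zero initial value, so Grönwall makes it vanish. -/
theorem mul_eq (h : IsEvolution Φ U t β) {s u r : ℝ} (hs : 0 ≤ s) (hsu : s ≤ u) (hur : u ≤ r)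
    (hrt : r ≤ t) : U r u * U u s = U r s := by
  have hu : 0 ≤ u := hs.trans hsu
  have key := norm_le_of_eq_add_integral (Φ := Φ) (D := fun v => U v u * U u s - U v s) (c := 0)
    (a := u) (b := t) (fun v hv => h.norm_le v ⟨hu.trans hv.1, hv.2⟩)
    (((h.continuousOn u hu).mul continuousOn_const).sub
      ((h.continuousOn s hs).mono (Icc_subset_Icc_left hsu))) ?_ ⟨hur, hrt⟩
  · rw [norm_zero, zero_mul] at key
    exact sub_eq_zero.1 (norm_le_zero_iff.1 key)
  · intro v hv
    have e1 : ∫ w in u..v, Φ w * (U w u * U u s - U w s) =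
        (∫ w in u..v, Φ w * U w u) * U u s - ∫ w in u..v, Φ w * U w s := by
      have e0 : (∫ w in u..v, Φ w * U w u) * U u s = ∫ w in u..v, Φ w * U w u * U u s := by
        rw [intervalIntegral.integral_of_le hv.1, intervalIntegral.integral_of_le hv.1]
        exact (integral_mul_const_of_integrable
          (h.intervalIntegrable_mul hu le_rfl hv.1 hv.2).1).symm
      rw [e0, ← intervalIntegral.integral_sub]
      · simp only [mul_sub, mul_assoc]
      · exact (h.intervalIntegrable_mul hu le_rfl hv.1 hv.2).mul_const _
      · exact h.intervalIntegrable_mul hs hsu hv.1 hv.2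
    have e2 : U v s = U u s + ∫ w in u..v, Φ w * U w s := by
      rw [h.eq_add_integral s v hs (hsu.trans hv.1) hv.2,
        h.eq_add_integral s u hs hsu (hv.1.trans hv.2), add_assoc,
        intervalIntegral.integral_add_adjacent_intervals
          (h.intervalIntegrable_mul hs le_rfl hsu (hv.1.trans hv.2))
          (h.intervalIntegrable_mul hs hsu hv.1 hv.2)]
    rw [e1, h.eq_add_integral u v hu hv.1 hv.2, e2, add_mul, one_mul]
    abel

variable {g : ℝ → ℝ}

/-- Zeroth order expansion of an evolution whose growth is controlled by `g`. -/
theorem norm_sub_one_le (h : IsEvolution Φ U t β) (hβ : 0 ≤ β)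
    (hg : MonotoneOn g (Icc 0 t))
    (hU : ∀ s r, 0 ≤ s → s ≤ r → r ≤ t → ‖U r s‖ ≤ Real.exp (g r - g s)) {a b : ℝ} (ha : 0 ≤ a)
    (hab : a ≤ b) (hbt : b ≤ t) : ‖U b a - 1‖ ≤ β * (b - a) * Real.exp (g b - g a) := by
  rw [h.eq_add_integral a b ha hab hbt, add_sub_cancel_left]
  have := intervalIntegral.norm_integral_le_of_norm_le_const (a := a) (b := b)
    (f := fun u => Φ u * U u a) (C := β * Real.exp (g b - g a)) (fun u hu => by
      rw [uIoc_of_le hab] at hu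
      have hu0 : 0 ≤ u := ha.trans hu.1.le
      refine (norm_mul_le _ _).trans (mul_le_mul (h.norm_le u ⟨hu0, hu.2.trans hbt⟩)
        ((hU a u ha hu.1.le (hu.2.trans hbt)).trans (Real.exp_le_exp.2 ?_)) (norm_nonneg _) hβ)
      exact sub_le_sub_right (hg ⟨hu0, hu.2.trans hbt⟩ ⟨ha.trans hab, hbt⟩ hu.2) _)
  rw [abs_of_nonneg (sub_nonneg.2 hab)] at this
  linarith

/-- First order expansion of an evolution whose growth is controlled by `g`. -/
theorem norm_sub_one_sub_integral_le (h : IsEvolution Φ U t β) (hβ : 0 ≤ β)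
    (hg : MonotoneOn g (Icc 0 t))
    (hU : ∀ s r, 0 ≤ s → s ≤ r → r ≤ t → ‖U r s‖ ≤ Real.exp (g r - g s)) {a b : ℝ} (ha : 0 ≤ a)
    (hab : a ≤ b) (hbt : b ≤ t) :
    ‖U b a - 1 - ∫ u in a..b, Φ u‖ ≤ (β * (b - a)) ^ 2 * Real.exp (g b - g a) := by
  rw [h.eq_add_integral a b ha hab hbt, add_sub_cancel_left, ← intervalIntegral.integral_sub
    (h.intervalIntegrable_mul ha le_rfl hab hbt) (h.intervalIntegrable a b ha hab hbt)]
  have := intervalIntegral.norm_integral_le_of_norm_le_const (a := a) (b := b)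
    (f := fun u => Φ u * U u a - Φ u) (C := β * (β * (b - a) * Real.exp (g b - g a))) (fun u hu => by
      rw [uIoc_of_le hab] at hu
      have hu0 : 0 ≤ u := ha.trans hu.1.le
      have hut := hu.2.trans hbt
      have e : Φ u * U u a - Φ u = Φ u * (U u a - 1) := by rw [mul_sub, mul_one]
      rw [e]
      refine (norm_mul_le _ _).trans (mul_le_mul (h.norm_le u ⟨hu0, hut⟩)
        ((h.norm_sub_one_le hβ hg hU ha hu.1.le hut).trans ?_) (norm_nonneg _) hβ)
      have h2 : u - a ≤ b - a := sub_le_sub_right hu.2 a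
      have h3 : g u - g a ≤ g b - g a :=
        sub_le_sub_right (hg ⟨hu0, hut⟩ ⟨ha.trans hab, hbt⟩ hu.2) _
      have h4 : 0 ≤ b - a := sub_nonneg.2 hab
      gcongr)
  rw [abs_of_nonneg (sub_nonneg.2 hab)] at this
  linarith

end IsEvolution

/-- First order expansion of an ordered product of factors close to `1`. -/
theorem norm_prod_expansion {E : Type*} [NormedRing E] (h1 : ‖(1 : E)‖ ≤ 1) {x : ℝ} (hx : 0 ≤ x) {K : ℕ} (f A : Fin K → E)
    (γ : Fin K → ℝ) (hγ : ∀ i, 0 ≤ γ i) (hf : ∀ i, ‖f i‖ ≤ Real.exp (γ i))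
    (hf1 : ∀ i, ‖f i - 1‖ ≤ x * Real.exp (γ i))
    (hf2 : ∀ i, ‖f i - 1 - A i‖ ≤ x ^ 2 * Real.exp (γ i)) :
    ‖(List.ofFn f).reverse.prod - 1‖ ≤ K * x * Real.exp (∑ i, γ i) ∧
    ‖(List.ofFn f).reverse.prod - 1 - ∑ i, A i‖ ≤ (K * x) ^ 2 * Real.exp (∑ i, γ i) := by
  induction K with
  | zero => simp
  | succ K ih =>
    have i1 := norm_reverse_prod_ofFn_le h1 (fun i : Fin K => f i.castSucc)
      (fun i => γ i.castSucc) (fun i => hf _)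
    obtain ⟨i2, i3⟩ := ih (fun i => f i.castSucc) (fun i => A i.castSucc)
      (fun i => γ i.castSucc) (fun i => hγ _) (fun i => hf _) (fun i => hf1 _) (fun i => hf2 _)
    rw [List.ofFn_succ', List.concat_eq_append, List.reverse_append, List.reverse_singleton,
      List.singleton_append, List.prod_cons, Fin.sum_univ_castSucc, Fin.sum_univ_castSucc]
    set P := (List.ofFn fun i : Fin K => f i.castSucc).reverse.prod
    set F := f (Fin.last K)
    set B := A (Fin.last K)
    set S := ∑ i : Fin K, γ i.castSucc
    set s := γ (Fin.last K)
    have j2 := hf1 (Fin.last K)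
    have j3 := hf2 (Fin.last K)
    have hS : 0 ≤ S := Finset.sum_nonneg fun i _ => hγ _
    have hs : 0 ≤ s := hγ _
    have hSe : 1 ≤ Real.exp S := Real.one_le_exp hS
    have hse : 1 ≤ Real.exp s := Real.one_le_exp hs
    rw [Real.exp_add]
    set p := Real.exp S
    set q := Real.exp s
    have hpq1 : p ≤ p * q := le_mul_of_one_le_right (by linarith) hse
    have hpq2 : q ≤ p * q := le_mul_of_one_le_left (by linarith) hSe
    refine ⟨?_, ?_⟩
    · have e : F * P - 1 = (F - 1) * P + (P - 1) := by noncomm_ring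
      rw [e]
      have k1 : ‖(F - 1) * P‖ ≤ x * q * p :=
        (norm_mul_le _ _).trans (mul_le_mul j2 i1 (norm_nonneg _) (by positivity))
      have k2 : K * x * p ≤ K * x * (p * q) := by gcongr
      refine (norm_add_le _ _).trans ?_
      push_cast
      linarith
    -- The product of the two deviations is of second order. The three terms contribute `K + 1 + K²
    -- ≤ (K + 1)²` times x²; `k4` is the slack K.
    · have e : F * P - 1 - (∑ i : Fin K, A i.castSucc + B) =
          (F - 1) * (P - 1) + (F - 1 - B) + (P - 1 - ∑ i : Fin K, A i.castSucc) := by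
        noncomm_ring
      rw [e]
      have k1 : ‖(F - 1) * (P - 1)‖ ≤ x * q * (K * x * p) :=
        (norm_mul_le _ _).trans (mul_le_mul j2 i2 (norm_nonneg _) (by positivity))
      have k2 : (K * x) ^ 2 * p ≤ (K * x) ^ 2 * (p * q) := by gcongr
      have k3 : x ^ 2 * q ≤ x ^ 2 * (p * q) := by gcongr
      have k4 : 0 ≤ K * x ^ 2 * (p * q) := by positivity
      refine (norm_add₃_le).trans ?_
      push_cast
      linarith

/-- Evolutions with coefficients `Φ i` and their sum. -/
theorem norm_sub_prod_le (h1 : ‖(1 : E)‖ ≤ 1) {K : ℕ} {t β : ℝ} (hβ : 0 ≤ β)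
    {Φ : Fin K → ℝ → E} {U : Fin K → ℝ → ℝ → E} {V : ℝ → ℝ → E}
    (hU : ∀ i, IsEvolution (Φ i) (U i) t β)
    (hV : IsEvolution (fun r => ∑ i, Φ i r) V t (K * β))
    {g : Fin K → ℝ → ℝ} (hg : ∀ i, MonotoneOn (g i) (Icc 0 t))
    (hUg : ∀ i s r, 0 ≤ s → s ≤ r → r ≤ t → ‖U i r s‖ ≤ Real.exp (g i r - g i s))
    (hVg : ∀ s r, 0 ≤ s → s ≤ r → r ≤ t → ‖V r s‖ ≤ Real.exp (∑ i, g i r - ∑ i, g i s))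
    {a b : ℝ} (ha : 0 ≤ a) (hab : a ≤ b) (hbt : b ≤ t) :
    ‖V b a - (List.ofFn fun i => U i b a).reverse.prod‖ ≤
      2 * K ^ 2 * β ^ 2 * (b - a) ^ 2 * Real.exp (∑ i, g i b - ∑ i, g i a) := by
  have ha' : a ∈ Icc 0 t := ⟨ha, hab.trans hbt⟩
  have hb' : b ∈ Icc 0 t := ⟨ha.trans hab, hbt⟩
  obtain ⟨-, p3⟩ := norm_prod_expansion h1 (x := β * (b - a))
    (mul_nonneg hβ (sub_nonneg.2 hab)) (fun i => U i b a) (fun i => ∫ u in a..b, Φ i u)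
    (fun i => g i b - g i a) (fun i => sub_nonneg.2 (hg i ha' hb' hab))
    (fun i => hUg i a b ha hab hbt)
    (fun i => (hU i).norm_sub_one_le hβ (hg i) (hUg i) ha hab hbt)
    (fun i => (hU i).norm_sub_one_sub_integral_le hβ (hg i) (hUg i) ha hab hbt)
  have hgs : MonotoneOn (fun r => ∑ i, g i r) (Icc 0 t) := fun x hx y hy hxy =>
    Finset.sum_le_sum fun i _ => hg i hx hy hxy
  have p4 := hV.norm_sub_one_sub_integral_le (by positivity) hgs hVg ha hab hbt
  rw [intervalIntegral.integral_finsetSum fun i _ => (hU i).intervalIntegrable a b ha hab hbt]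
    at p4
  rw [Finset.sum_sub_distrib] at p3
  set P := (List.ofFn fun i => U i b a).reverse.prod
  -- Both evolutions share this first order part, and each remainder is at most `(Kβ(b - a))²` times
  -- the growth factor, whence the constant 2.
  have e : V b a - P = (V b a - 1 - ∑ i, ∫ u in a..b, Φ i u) -
      (P - 1 - ∑ i, ∫ u in a..b, Φ i u) := by abel
  rw [e]
  refine (norm_sub_le _ _).trans ((add_le_add p4 p3).trans (le_of_eq ?_))
  ring

/-- The increments of the g i add up within a cell and telescope over the cells. -/
theorem norm_trotter_le {E : Type*} [NormedRing E] (h1 : ‖(1 : E)‖ ≤ 1) {K : ℕ} {t : ℝ} {U : Fin K → ℝ → ℝ → E}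
    {g : Fin K → ℝ → ℝ}
    (hUg : ∀ i s r, 0 ≤ s → s ≤ r → r ≤ t → ‖U i r s‖ ≤ Real.exp (g i r - g i s))
    {p : ℕ → ℝ} (hp : Monotone p) (hp0 : 0 ≤ p 0) (n : ℕ) (hn : p n ≤ t) :
    ‖(List.ofFn fun j : Fin n =>
        (List.ofFn fun i => U i (p (j + 1)) (p j)).reverse.prod).reverse.prod‖ ≤
      Real.exp (∑ i, g i (p n) - ∑ i, g i (p 0)) := by
  refine (norm_reverse_prod_ofFn_le h1 _
    (fun j : Fin n => ∑ i, g i (p (j + 1)) - ∑ i, g i (p j)) fun j => ?_).trans (le_of_eq ?_)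
  · rw [← Finset.sum_sub_distrib]
    exact norm_reverse_prod_ofFn_le h1 _ _ fun i => hUg i _ _ (hp0.trans (hp (Nat.zero_le _)))
      (hp (Nat.le_succ _)) ((hp j.2).trans hn)
  · rw [Fin.sum_univ_eq_sum_range (fun j => ∑ i, g i (p (j + 1)) - ∑ i, g i (p j)),
      Finset.sum_range_sub (fun j => ∑ i, g i (p j))]

/-- Error of the product formula along an equidistant partition `p`. -/
theorem norm_sub_trotter_le (h1 : ‖(1 : E)‖ ≤ 1) {K : ℕ} {t β : ℝ} (hβ : 0 ≤ β)
    {Φ : Fin K → ℝ → E} {U : Fin K → ℝ → ℝ → E} {V : ℝ → ℝ → E}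
    (hU : ∀ i, IsEvolution (Φ i) (U i) t β)
    (hV : IsEvolution (fun r => ∑ i, Φ i r) V t (K * β))
    {g : Fin K → ℝ → ℝ} (hg : ∀ i, MonotoneOn (g i) (Icc 0 t))
    (hUg : ∀ i s r, 0 ≤ s → s ≤ r → r ≤ t → ‖U i r s‖ ≤ Real.exp (g i r - g i s))
    (hVg : ∀ s r, 0 ≤ s → s ≤ r → r ≤ t → ‖V r s‖ ≤ Real.exp (∑ i, g i r - ∑ i, g i s))
    (p : ℕ → ℝ) {τ : ℝ} (hτ : 0 ≤ τ) (hp0 : 0 ≤ p 0) (hp : ∀ j, p (j + 1) = p j + τ)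
    (n : ℕ) (hn : p n ≤ t) :
    ‖V (p n) (p 0) - (List.ofFn fun j : Fin n =>
        (List.ofFn fun i => U i (p (j + 1)) (p j)).reverse.prod).reverse.prod‖ ≤
      n * (2 * K ^ 2 * β ^ 2 * τ ^ 2) * Real.exp (∑ i, g i (p n) - ∑ i, g i (p 0)) := by
  have hmono : Monotone p := monotone_nat_of_le_succ fun j => by rw [hp]; linarith
  induction n with
  | zero => simp [hV.self hp0 hn]
  | succ n ih =>
    have hle : p n ≤ p (n + 1) := hmono n.le_succ
    have i1 := norm_trotter_le h1 hUg hmono hp0 n (hle.trans hn)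
    have i2 := ih (hle.trans hn)
    have hpn : 0 ≤ p n := hp0.trans (hmono n.zero_le)
    have j2 := norm_sub_prod_le h1 hβ hU hV hg hUg hVg hpn hle hn
    have hVn := hVg _ _ hpn hle hn
    rw [List.ofFn_succ', List.concat_eq_append, List.reverse_append, List.reverse_singleton,
      List.singleton_append, List.prod_cons, ← hV.mul_eq hp0 (hmono n.zero_le) hle hn]
    simp only [Fin.val_castSucc, Fin.val_last]
    set P := (List.ofFn fun j : Fin n =>
      (List.ofFn fun i => U i (p (j + 1)) (p j)).reverse.prod).reverse.prod
    set F := (List.ofFn fun i => U i (p (n + 1)) (p n)).reverse.prod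
    have hτ' : p (n + 1) - p n = τ := by rw [hp]; ring
    rw [hτ'] at j2
    have he : Real.exp (∑ i, g i (p (n + 1)) - ∑ i, g i (p 0)) =
        Real.exp (∑ i, g i (p (n + 1)) - ∑ i, g i (p n)) *
          Real.exp (∑ i, g i (p n) - ∑ i, g i (p 0)) := by
      rw [← Real.exp_add]
      congr 1
      ring
    rw [he]
    set x := Real.exp (∑ i, g i (p (n + 1)) - ∑ i, g i (p n))
    set y := Real.exp (∑ i, g i (p n) - ∑ i, g i (p 0))
    have hx : 0 ≤ x := (Real.exp_pos _).le
    -- The old error is propagated by the exact evolution, the new local error acts after the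
    -- approximate one. Both stability bounds carry the same exponents, so each term gets the factor
    -- x y.
    have e : V (p (n + 1)) (p n) * V (p n) (p 0) - F * P =
        V (p (n + 1)) (p n) * (V (p n) (p 0) - P) + (V (p (n + 1)) (p n) - F) * P := by
      noncomm_ring
    rw [e]
    have k1 := (norm_mul_le (V (p (n + 1)) (p n)) (V (p n) (p 0) - P)).trans
      (mul_le_mul hVn i2 (norm_nonneg _) hx)
    have k2 := (norm_mul_le (V (p (n + 1)) (p n) - F) P).trans
      (mul_le_mul j2 i1 (norm_nonneg _) (by positivity))
    refine (norm_add_le _ _).trans ((add_le_add k1 k2).trans (le_of_eq ?_))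
    push_cast
    ring

/-- The growth of the evolution of the sum is controlled by the growth of the parts. -/
theorem norm_le_exp_sum (h1 : ‖(1 : E)‖ ≤ 1) {K : ℕ} {t β : ℝ} (hβ : 0 ≤ β)
    {Φ : Fin K → ℝ → E} {U : Fin K → ℝ → ℝ → E} {V : ℝ → ℝ → E}
    (hU : ∀ i, IsEvolution (Φ i) (U i) t β)
    (hV : IsEvolution (fun r => ∑ i, Φ i r) V t (K * β))
    {g : Fin K → ℝ → ℝ}
    (hUg : ∀ i s r, 0 ≤ s → s ≤ r → r ≤ t → ‖U i r s‖ ≤ Real.exp (g i r - g i s))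
    {s r : ℝ} (hs : 0 ≤ s) (hsr : s ≤ r) (hrt : r ≤ t) :
    ‖V r s‖ ≤ Real.exp (∑ i, g i r - ∑ i, g i s) := by
  set c := 2 * K ^ 2 * β ^ 2 * (r - s) ^ 2 *
    Real.exp (∑ _i : Fin K, β * r - ∑ _i : Fin K, β * s) with hc
  -- V is within c/(n+1) of a product over n+1 cells, and that product obeys the desired bound. The
  -- error is estimated with the crude growth β r, for which V is controlled by Grönwall alone, so
  -- there is no circularity.
  have hn : ∀ n : ℕ, ‖V r s‖ ≤
      Real.exp (∑ i, g i r - ∑ i, g i s) + c * (1 / ((n : ℝ) + 1)) := by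
    intro n
    have hn1 : (0 : ℝ) < n + 1 := by positivity
    set p : ℕ → ℝ := fun j => s + j * ((r - s) / (n + 1)) with hp
    have hτ : 0 ≤ (r - s) / (n + 1) := div_nonneg (sub_nonneg.2 hsr) hn1.le
    have hp0 : p 0 = s := by simp [hp]
    have hpn : p (n + 1) = r := by
      simp only [hp]
      push_cast
      field_simp
      ring
    have hps : ∀ j, p (j + 1) = p j + (r - s) / (n + 1) := by
      intro j
      simp only [hp]
      push_cast
      ring
    have k1 := norm_trotter_le h1 hUg
      (monotone_nat_of_le_succ fun j => by rw [hps]; linarith) (hs.trans_eq hp0.symm) (n + 1)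
      (hpn.trans_le hrt)
    have k2 := norm_sub_trotter_le h1 hβ hU hV (g := fun _ r => β * r)
      (fun i x _ y _ hxy => mul_le_mul_of_nonneg_left hxy hβ)
      (fun i s r hs hsr hrt => by
        rw [← mul_sub]
        exact (hU i).norm_le_exp h1 hs hsr hrt)
      (fun s r hs hsr hrt => by
        refine (hV.norm_le_exp h1 hs hsr hrt).trans (Real.exp_le_exp.2 (le_of_eq ?_))
        simp only [Finset.sum_const, Finset.card_univ, Fintype.card_fin, nsmul_eq_mul]
        ring) p hτ (hs.trans_eq hp0.symm) hps (n + 1) (hpn.trans_le hrt)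
    rw [hp0, hpn] at k1 k2
    refine (norm_le_norm_add_norm_sub' _ _).trans (add_le_add k1 (k2.trans (le_of_eq ?_)))
    rw [hc]
    push_cast
    field_simp
  have hlim : Tendsto (fun n : ℕ => Real.exp (∑ i, g i r - ∑ i, g i s) + c * (1 / ((n : ℝ) + 1)))
      atTop (𝓝 (Real.exp (∑ i, g i r - ∑ i, g i s) + c * 0)) :=
    (tendsto_one_div_add_atTop_nhds_zero_nat.const_mul c).const_add _
  rw [mul_zero, add_zero] at hlim
  exact ge_of_tendsto' hlim hn

end Evolution

/-! ### Growth functions from grids. -/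

section Growth

variable {E : Type*} [NormedRing E] [NormedAlgebra ℝ E] {Φ : ℝ → E} {U : ℝ → ℝ → E} {t β : ℝ}

theorem IsEvolution.norm_grid_le (h : IsEvolution Φ U t β) (h1 : ‖(1 : E)‖ ≤ 1) {p : ℕ → ℝ}
    (hp : Monotone p) (hp0 : 0 ≤ p 0) {x : ℕ → ℝ} {n : ℕ} (hpn : p n ≤ t)
    (hx : ∀ j < n, ‖U (p (j + 1)) (p j)‖ ≤ Real.exp (x j)) {a b : ℕ} (hab : a ≤ b) (hbn : b ≤ n) :
    ‖U (p b) (p a)‖ ≤ Real.exp (∑ j ∈ Finset.range b, x j - ∑ j ∈ Finset.range a, x j) := by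
  have hpos : ∀ j, 0 ≤ p j := fun j => hp0.trans (hp (Nat.zero_le j))
  have hle : ∀ j ≤ n, p j ≤ t := fun j hj => (hp hj).trans hpn
  induction b, hab using Nat.le_induction with
  | base => simpa [h.self (hpos a) (hle a hbn)] using h1
  | succ b hab ih =>
    rw [← h.mul_eq (hpos a) (hp hab) (hp b.le_succ) (hle _ hbn), Finset.sum_range_succ,
      add_sub_right_comm, add_comm, Real.exp_add]
    exact (norm_mul_le _ _).trans (mul_le_mul (hx b hbn) (ih (b.le_succ.trans hbn))
      (norm_nonneg _) (Real.exp_pos _).le)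

/-- Growth of an evolution between arbitrary times in terms of its growth on the cells of the grid
with `n` cells. -/
theorem IsEvolution.norm_le_of_grid (h : IsEvolution Φ U t β) (h1 : ‖(1 : E)‖ ≤ 1)
    (hβ : 0 ≤ β) {n : ℕ} (hn : 0 < n) {x : ℕ → ℝ} (hx0 : ∀ j, 0 ≤ x j)
    (hx : ∀ j < n, ‖U (t * (j + 1) / n) (t * j / n)‖ ≤ Real.exp (x j)) {s r : ℝ} (hs : 0 ≤ s)
    (hsr : s ≤ r) (hrt : r ≤ t) :
    ‖U r s‖ ≤ Real.exp (∑ j ∈ Finset.range ⌊r * n / t⌋₊, x j -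
      ∑ j ∈ Finset.range ⌊s * n / t⌋₊, x j + 2 * (β * (t / n))) := by
  have hn' : (0 : ℝ) < n := by exact_mod_cast hn
  have ht0 : 0 ≤ t := hs.trans (hsr.trans hrt)
  have hb0 : 0 ≤ β * (t / n) := by positivity
  rcases ht0.eq_or_lt with rfl | ht
  · have hs0 : s = 0 := le_antisymm (hsr.trans hrt) hs
    have hr0 : r = 0 := le_antisymm hrt (hs.trans hsr)
    subst hs0 hr0
    rw [h.self le_rfl le_rfl]
    simpa using h1
  set a := ⌊s * n / t⌋₊ with ha
  set b := ⌊r * n / t⌋₊ with hb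
  set p : ℕ → ℝ := fun j => t * j / n with hp
  have hr0 : 0 ≤ r := hs.trans hsr
  have ha1 : s < p (a + 1) := by
    have := Nat.lt_floor_add_one (s * n / t)
    rw [← ha, div_lt_iff₀ ht] at this
    simp only [hp]
    push_cast
    rw [lt_div_iff₀ hn']
    linarith
  have ha2 : p a ≤ s := by
    have := Nat.floor_le (div_nonneg (mul_nonneg hs hn'.le) ht0)
    rw [← ha, le_div_iff₀ ht] at this
    simp only [hp]
    rw [div_le_iff₀ hn']
    linarith
  have hb1 : r < p (b + 1) := by
    have := Nat.lt_floor_add_one (r * n / t)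
    rw [← hb, div_lt_iff₀ ht] at this
    simp only [hp]
    push_cast
    rw [lt_div_iff₀ hn']
    linarith
  have hb2 : p b ≤ r := by
    have := Nat.floor_le (div_nonneg (mul_nonneg hr0 hn'.le) ht0)
    rw [← hb, le_div_iff₀ ht] at this
    simp only [hp]
    rw [div_le_iff₀ hn']
    linarith
  have hps : ∀ j, p (j + 1) = p j + t / n := by
    intro j
    simp only [hp]
    push_cast
    ring
  have htn : 0 ≤ t / n := by positivity
  have hpm : Monotone p := monotone_nat_of_le_succ fun j => by rw [hps]; linarith
  have hab : a ≤ b := Nat.floor_le_floor (by gcongr)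
  have hbn : b ≤ n := by
    apply Nat.floor_le_of_le
    rw [div_le_iff₀ ht]
    nlinarith
  have hp0 : 0 ≤ p 0 := by simp [hp]
  have hsum : ∑ j ∈ Finset.range a, x j ≤ ∑ j ∈ Finset.range b, x j :=
    Finset.sum_le_sum_of_subset_of_nonneg (Finset.range_subset_range.2 hab) fun j _ _ => hx0 j
  -- Either s and r lie in the same cell, and the crude bound over one cell is enough, or [s, r]
  -- consists of full cells a+1, …, b-1 and two partial cells, each costing at most β t/n.
  rcases hab.eq_or_lt with hab' | hab'
  · refine (h.norm_le_exp h1 hs hsr hrt).trans (Real.exp_le_exp.2 ?_)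
    rw [← hab', hps] at hb1
    have : β * (r - s) ≤ β * (t / n) := by
      gcongr
      linarith
    linarith
  · have hp1 : 0 ≤ p (a + 1) := hs.trans ha1.le
    have hpab : p (a + 1) ≤ p b := hpm hab'
    have hpbt : p b ≤ t := hb2.trans hrt
    rw [← h.mul_eq hs (ha1.le.trans hpab) hb2 hrt, ← h.mul_eq hs ha1.le hpab hpbt]
    have k1 := h.norm_le_exp h1 (hp1.trans hpab) hb2 hrt
    have k2 : ‖U (p b) (p (a + 1))‖ ≤ _ := h.norm_grid_le h1 hpm hp0 (n := n)
      (le_of_eq (by simp only [hp]; field_simp)) (x := x) (fun j hj => by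
        have := hx j hj
        simp only [hp]
        push_cast
        exact this) hab' hbn
    have k3 := h.norm_le_exp h1 hs ha1.le (hpab.trans hpbt)
    have l1 : β * (r - p b) ≤ β * (t / n) := by
      rw [hps] at hb1
      gcongr
      linarith
    have l3 : β * (p (a + 1) - s) ≤ β * (t / n) := by
      rw [hps]
      gcongr
      linarith
    -- The full cells start at a+1, while the claimed sum also includes the weight of cell a.
    have l2 := hx0 a
    rw [Finset.sum_range_succ] at k2
    refine (norm_mul_le _ _).trans ((mul_le_mul k1 ((norm_mul_le _ _).trans
      (mul_le_mul k2 k3 (norm_nonneg _) (Real.exp_pos _).le)) (norm_nonneg _)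
      (Real.exp_pos _).le).trans ?_)
    rw [← Real.exp_add, ← Real.exp_add]
    exact Real.exp_le_exp.2 (by linarith)

/-- If the growth of an evolution on the cells of the `n`-th grid is governed by weights `x n`
whose sum tends to `T`, then its growth is governed by a function with total increment at
most `T`. -/
theorem IsEvolution.exists_growth (h : IsEvolution Φ U t β) (h1 : ‖(1 : E)‖ ≤ 1)
    (hβ : 0 ≤ β) {x : ℕ → ℕ → ℝ} (hx0 : ∀ n j, 0 ≤ x n j)
    (hx : ∀ n : ℕ, ∀ j < n, ‖U (t * (j + 1) / n) (t * j / n)‖ ≤ Real.exp (x n j)) {T : ℝ}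
    (ht : 0 ≤ t) (hT : Tendsto (fun n => ∑ j ∈ Finset.range n, x n j) atTop (𝓝 T)) :
    ∃ g : ℝ → ℝ, MonotoneOn g (Icc 0 t) ∧ g t - g 0 ≤ T ∧
      ∀ s r, 0 ≤ s → s ≤ r → r ≤ t → ‖U r s‖ ≤ Real.exp (g r - g s) := by
  -- The total weight of the cells of the n-th grid that end by time s.
  set F : ℕ → ℝ → ℝ := fun (n : ℕ) s => ∑ j ∈ Finset.range ⌊s * (n : ℝ) / t⌋₊, x n j with hF
  have hFmono : ∀ n, Monotone (F n) := fun n s r hsr =>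
    Finset.sum_le_sum_of_subset_of_nonneg
      (Finset.range_subset_range.2 (Nat.floor_le_floor (by gcongr))) fun j _ _ => hx0 n j
  have hF0 : ∀ n s, 0 ≤ F n s := fun n s => Finset.sum_nonneg fun j _ => hx0 n j
  have hFt : ∀ n s, s ≤ t → F n s ≤ ∑ j ∈ Finset.range n, x n j := by
    intro n s hs
    refine Finset.sum_le_sum_of_subset_of_nonneg (Finset.range_subset_range.2
      (Nat.floor_le_of_le ?_)) fun j _ _ => hx0 n j
    rw [mul_comm, mul_div_assoc]
    exact mul_le_of_le_one_right (Nat.cast_nonneg n) (div_le_one_of_le₀ hs ht)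
  -- Limits along a nonprincipal ultrafilter exist for all s at once by compactness, so no
  -- convergent subsequence has to be selected; the total weight bounds F for s ≤ t.
  have hle : (hyperfilter ℕ : Filter ℕ) ≤ atTop := Nat.hyperfilter_le_atTop
  have hex : ∀ s, ∃ y, s ≤ t → Tendsto (fun n => F n s) (hyperfilter ℕ) (𝓝 y) := by
    intro s
    by_cases hs : s ≤ t
    · have hmem : ((hyperfilter ℕ).map (fun n => F n s) : Filter ℝ) ≤ 𝓟 (Icc 0 (T + 1)) := by
        rw [le_principal_iff]
        refine hle ?_
        filter_upwards [hT.eventually_le_const (lt_add_one T)] with n hn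
        exact ⟨hF0 n s, (hFt n s hs).trans hn⟩
      obtain ⟨y, -, hy⟩ := isCompact_Icc.ultrafilter_le_nhds _ hmem
      exact ⟨y, fun _ => hy⟩
    · exact ⟨0, fun h => absurd h hs⟩
  choose g hg using hex
  refine ⟨g, fun s hs r hr hsr => ?_, ?_, fun s r hs hsr hrt => ?_⟩
  · exact le_of_tendsto_of_tendsto' (hg s hs.2) (hg r hr.2) fun n => hFmono n hsr
  · have k1 : 0 ≤ g 0 := ge_of_tendsto' (hg 0 ht) fun n => hF0 n 0
    have k2 : g t ≤ T := le_of_tendsto_of_tendsto' (hg t le_rfl) (hT.mono_left hle)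
      fun n => hFt n t le_rfl
    linarith
  -- The cost `2βt/n` of the two partial cells disappears in the limit.
  · have hlim : Tendsto (fun n : ℕ => Real.exp (F n r - F n s + 2 * (β * (t / n))))
        (hyperfilter ℕ) (𝓝 (Real.exp (g r - g s + 2 * (β * 0)))) := by
      refine (Real.continuous_exp.tendsto _).comp (((hg r hrt).sub (hg s (hsr.trans hrt))).add ?_)
      exact (((tendsto_const_div_atTop_nhds_zero_nat t).mono_left hle).const_mul β).const_mul 2
    rw [mul_zero, mul_zero, add_zero] at hlim
    refine ge_of_tendsto hlim (hle ?_)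
    filter_upwards [eventually_gt_atTop 0] with n hn
    exact h.norm_le_of_grid h1 hβ hn (hx0 n) (hx n) hs hsr hrt

end Growth

/-! ### Superoperators as a Banach algebra under the 1 → 1 norm. -/

section TraceNormSpace

/-- The space of matrices with the trace norm. -/
def TraceNormMatrix (ι : Type*) : Type _ := Matrix ι ι ℂ

namespace TraceNormMatrix

variable {ι : Type*}

noncomputable instance : AddCommGroup (TraceNormMatrix ι) :=
  inferInstanceAs (AddCommGroup (Matrix ι ι ℂ))

noncomputable instance : Module ℂ (TraceNormMatrix ι) :=
  inferInstanceAs (Module ℂ (Matrix ι ι ℂ))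

/-- The identity map to the space of matrices with the trace norm. -/
noncomputable def equiv (ι : Type*) : Matrix ι ι ℂ ≃ₗ[ℂ] TraceNormMatrix ι :=
  LinearEquiv.refl ℂ (Matrix ι ι ℂ)

variable [Fintype ι] [DecidableEq ι]

noncomputable instance : Norm (TraceNormMatrix ι) := ⟨fun A => schattenOne ((equiv ι).symm A)⟩

theorem norm_def (A : TraceNormMatrix ι) : ‖A‖ = schattenOne ((equiv ι).symm A) := rfl

theorem normedSpaceCore : NormedSpace.Core ℂ (TraceNormMatrix ι) where
  norm_nonneg A := schattenOne_nonneg _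
  norm_smul c A := by rw [norm_def, map_smul, schattenOne_smul, norm_def]
  norm_triangle A B := by
    rw [norm_def, map_add]
    exact schattenOne_add_le _ _
  norm_eq_zero_iff A := by
    rw [norm_def, schattenOne_eq_zero_iff, LinearEquiv.map_eq_zero_iff]

noncomputable instance : NormedAddCommGroup (TraceNormMatrix ι) :=
  NormedAddCommGroup.ofCore normedSpaceCore

noncomputable instance : NormedSpace ℂ (TraceNormMatrix ι) :=
  NormedSpace.ofCore normedSpaceCore

instance : FiniteDimensional ℂ (TraceNormMatrix ι) :=
  (equiv ι).finiteDimensional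

instance : CompleteSpace (TraceNormMatrix ι) := FiniteDimensional.complete ℂ _

/-- Carries the continuity and limits of the definitions, stated in the usual matrix topology, over
to the trace norm. -/
theorem continuous_equiv : Continuous (equiv ι) :=
  LinearMap.continuous_of_finiteDimensional (equiv ι).toLinearMap

end TraceNormMatrix

variable {ι : Type*} [Fintype ι] [DecidableEq ι]

/-- Superoperators as bounded operators on the space of matrices with the trace norm. -/
noncomputable def SuperOp.toTraceNorm (ι : Type*) [Fintype ι] [DecidableEq ι] :
    SuperOp ι ≃ₐ[ℂ] (TraceNormMatrix ι →L[ℂ] TraceNormMatrix ι) :=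
  ((TraceNormMatrix.equiv ι).conjAlgEquiv ℂ).trans
    (Module.End.toContinuousLinearMap (TraceNormMatrix ι))

open SuperOp TraceNormMatrix

theorem SuperOp.norm_toTraceNorm_le_iff (T : SuperOp ι) {M : ℝ} (hM : 0 ≤ M) :
    ‖toTraceNorm ι T‖ ≤ M ↔ ∀ A, schattenOne (T A) ≤ M * schattenOne A :=
  ContinuousLinearMap.opNorm_le_iff hM

theorem schattenOne_apply_le (T : SuperOp ι) (A : Matrix ι ι ℂ) :
    schattenOne (T A) ≤ ‖toTraceNorm ι T‖ * schattenOne A :=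
  (T.norm_toTraceNorm_le_iff (norm_nonneg _)).1 le_rfl A

theorem oneNorm_nonneg (T : SuperOp ι) : 0 ≤ oneNorm T := by
  refine Real.sSup_nonneg ?_
  rintro _ ⟨A, -, rfl⟩
  exact schattenOne_nonneg _

/-- Homogeneity reduces every nonzero A to ‖A‖₁ = 1. For an empty index type no such A exists, and
`sSup ∅ = 0` still agrees with the operator norm. -/
theorem norm_toTraceNorm (T : SuperOp ι) : ‖toTraceNorm ι T‖ = oneNorm T := by
  have hub : ∀ x ∈ {x | ∃ A : Matrix ι ι ℂ, schattenOne A = 1 ∧ x = schattenOne (T A)},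
      x ≤ ‖toTraceNorm ι T‖ := by
    rintro _ ⟨A, hA, rfl⟩
    simpa [hA] using schattenOne_apply_le T A
  refine le_antisymm ?_ (Real.sSup_le hub (norm_nonneg _))
  rw [T.norm_toTraceNorm_le_iff (oneNorm_nonneg T)]
  intro A
  rcases (schattenOne_nonneg A).eq_or_lt with h | h
  · rw [(schattenOne_eq_zero_iff A).1 h.symm, map_zero, (schattenOne_eq_zero_iff _).2 rfl,
      mul_zero]
  · have h1 : schattenOne (T (((schattenOne A)⁻¹ : ℂ) • A)) ≤ oneNorm T := by
      refine le_csSup ⟨_, hub⟩ ⟨_, ?_, rfl⟩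
      rw [schattenOne_smul, norm_inv, Complex.norm_real, Real.norm_of_nonneg h.le,
        inv_mul_cancel₀ h.ne']
    rwa [map_smul, schattenOne_smul, norm_inv, Complex.norm_real, Real.norm_of_nonneg h.le,
      inv_mul_le_iff₀ h, mul_comm] at h1

theorem IsQuantumChannel.norm_toTraceNorm_le {T : SuperOp ι} (hT : IsQuantumChannel T) :
    ‖toTraceNorm ι T‖ ≤ 1 := by
  rw [T.norm_toTraceNorm_le_iff zero_le_one]
  intro A
  rw [one_mul]
  exact hT.schattenOne_le A

theorem PiecewiseContinuous.exists_norm_le {L : ℝ → SuperOp ι} (hL : PiecewiseContinuous L)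
    (t : ℝ) : ∃ M, ∀ u ∈ Icc 0 t, ‖toTraceNorm ι (L u)‖ ≤ M := by
  refine bounded_of_oneSidedLimits (fun u => (TraceNormMatrix.equiv ι).conj (L u)) ?_ ?_ 0 t le_rfl
  · intro r hr
    obtain ⟨l, hl⟩ := hL.rightLimit r hr
    exact ⟨(TraceNormMatrix.equiv ι).conj l, fun A => (continuous_equiv.tendsto _).comp (hl _)⟩
  · intro r hr
    obtain ⟨l, hl⟩ := hL.leftLimit r hr
    exact ⟨(TraceNormMatrix.equiv ι).conj l, fun A => (continuous_equiv.tendsto _).comp (hl _)⟩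

section

attribute [local instance] Matrix.normedAddCommGroup Matrix.normedSpace

theorem TraceNormMatrix.hasDerivAt_equiv {f : ℝ → Matrix ι ι ℂ} {f' : Matrix ι ι ℂ} {r : ℝ}
    (hf : HasDerivAt f f' r) :
    HasDerivAt (fun u => TraceNormMatrix.equiv ι (f u)) (TraceNormMatrix.equiv ι f') r :=
  ((LinearMap.toContinuousLinearMap
    (TraceNormMatrix.equiv ι).toLinearMap).restrictScalars ℝ).hasFDerivAt.comp_hasDerivAt r hf

end

/-- The differential equation may fail at the finitely many jumps of L, but the solution is
continuous there, so the fundamental theorem of calculus off a countable set gives the integral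
equation. It is applied to each matrix separately, since derivatives are given pointwise. -/
theorem SolvesIVP.isEvolution {L : ℝ → SuperOp ι} (hL : PiecewiseContinuous L)
    {T : ℝ → ℝ → SuperOp ι} (hT : SolvesIVP L T) {t β : ℝ}
    (hβ : ∀ u ∈ Icc 0 t, ‖toTraceNorm ι (L u)‖ ≤ β) :
    IsEvolution (fun u => toTraceNorm ι (L u)) (fun r s => toTraceNorm ι (T r s)) t β := by
  have hc : ∀ r, 0 ≤ r → ∃ F : Finset ℝ,
      ContinuousOn (fun u => toTraceNorm ι (L u)) (Icc 0 r \ F) := by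
    intro r hr
    obtain ⟨F, hF⟩ := hL.continuousOn r
    exact ⟨F, continuousOn_clm_apply.2 fun A => continuous_equiv.comp_continuousOn (hF _)⟩
  have hint : ∀ s r, 0 ≤ s → s ≤ r → r ≤ t →
      IntervalIntegrable (fun u => toTraceNorm ι (L u)) volume s r := by
    intro s r hs hsr hrt
    obtain ⟨F, hF⟩ := hc r (hs.trans hsr)
    exact intervalIntegrable_of_bounded_of_continuousOn F hsr
      (fun u hu => hβ u ⟨hs.trans hu.1, hu.2.trans hrt⟩)
      (hF.mono (sdiff_subset_sdiff_left (Icc_subset_Icc_left hs)))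
  have hcont : ∀ s, 0 ≤ s → ContinuousOn (fun r => toTraceNorm ι (T r s)) (Ici s) := fun s hs =>
    continuousOn_clm_apply.2 fun A => continuous_equiv.comp_continuousOn (hT.continuousOn s hs _)
  refine ⟨hβ, hint, fun s hs => (hcont s hs).mono Icc_subset_Ici_self, fun s r hs hsr hrt => ?_⟩
  have hi : IntervalIntegrable (fun u => toTraceNorm ι (L u) * toTraceNorm ι (T u s)) volume s r :=
    (hint s r hs hsr hrt).mul_continuousOn (by
      rw [uIcc_of_le hsr]
      exact (hcont s hs).mono Icc_subset_Ici_self)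
  rw [← sub_eq_iff_eq_add']
  refine ContinuousLinearMap.ext fun A => ?_
  rw [ContinuousLinearMap.intervalIntegral_apply hi]
  obtain ⟨F, hF⟩ := hL.continuousOn r
  have hiA : IntervalIntegrable (fun u => (toTraceNorm ι (L u) * toTraceNorm ι (T u s)) A)
      volume s r :=
    ⟨hi.1.apply_continuousLinearMap A, hi.2.apply_continuousLinearMap A⟩
  rw [MeasureTheory.integral_eq_of_hasDerivAt_off_countable_of_le
    (fun u => toTraceNorm ι (T u s) A)
    (fun u => (toTraceNorm ι (L u) * toTraceNorm ι (T u s)) A) hsr F.countable_toSet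
    (((hcont s hs).mono Icc_subset_Ici_self).clm_apply continuousOn_const) ?_
    hiA]
  · rw [hT.initial s hs, map_one]
    rfl
  · intro u hu
    have hcu : ∀ A, ContinuousAt (fun v => L v A) u := fun A => (hF A).continuousAt (by
      rw [sdiff_eq]
      exact inter_mem (Icc_mem_nhds (hs.trans_lt hu.1.1) hu.1.2)
        (F.finite_toSet.isClosed.isOpen_compl.mem_nhds hu.2))
    exact hasDerivAt_equiv (hT.hasDerivAt s u hs hu.1.1 hcu ((TraceNormMatrix.equiv ι).symm A))

end TraceNormSpace

/-! ### Application to local systems. -/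

namespace LocalSystem

open SuperOp

variable {Λ : Type*} [Fintype Λ] [DecidableEq Λ] {d k K : ℕ} (S : LocalSystem Λ d k K)

theorem beta_nonneg (t : ℝ) : 0 ≤ S.beta t := by
  refine Real.sSup_nonneg ?_
  rintro _ ⟨r, -, i, rfl⟩
  exact oneNorm_nonneg _

theorem norm_term_le_beta {t r : ℝ} (hr : r ∈ Icc 0 t) (i : Fin K) :
    ‖toTraceNorm _ (S.term i r)‖ ≤ S.beta t := by
  choose M hM using fun i => (S.piecewiseContinuous i).exists_norm_le t
  rw [norm_toTraceNorm]
  -- A real `sSup` dominates its set only if the set is bounded above; piecewise continuity supplies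
  -- the bounds M i.
  refine le_csSup ⟨∑ i, |M i|, ?_⟩ ⟨r, hr, i, rfl⟩
  rintro _ ⟨u, hu, j, rfl⟩
  rw [← norm_toTraceNorm]
  exact ((hM j u hu).trans (le_abs_self _)).trans
    (Finset.single_le_sum (f := fun i => |M i|) (fun i _ => abs_nonneg _) (Finset.mem_univ j))

theorem isEvolution_term (t : ℝ) (i : Fin K) :
    IsEvolution (fun u => toTraceNorm _ (S.term i u))
      (fun r s => toTraceNorm _ (propagator (S.term i) r s)) t (S.beta t) :=
  (propagator_solvesIVP (S.piecewiseContinuous i)).isEvolution (S.piecewiseContinuous i)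
    fun _ hu => S.norm_term_le_beta hu i

theorem isEvolution_liouvillian (t : ℝ) :
    IsEvolution (fun u => ∑ i, toTraceNorm _ (S.term i u))
      (fun r s => toTraceNorm _ (propagator S.liouvillian r s)) t (K * S.beta t) := by
  have h := (propagator_solvesIVP S.piecewiseContinuous_liouvillian).isEvolution
    S.piecewiseContinuous_liouvillian (t := t) (β := K * S.beta t) (fun u hu => by
      rw [liouvillian, map_sum]
      refine (norm_sum_le_of_le _ fun i _ => S.norm_term_le_beta hu i).trans (le_of_eq ?_)
      simp)
  simpa only [liouvillian, map_sum] using h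

/-- Channels contract, and Grönwall covers the other cells; the factor `Ch` merges both cases into
one exponent, whose sum over the cells is β times the total non-channel length. -/
theorem norm_step_le {t : ℝ} {n : ℕ} {j : ℕ} (hj : j < n) (ht : 0 ≤ t) (i : Fin K) :
    ‖toTraceNorm _ (S.step t n i j)‖ ≤ Real.exp (S.beta t * (Ch (S.step t n i j) * (t / n))) := by
  have hn : (0 : ℝ) < n := by exact_mod_cast (Nat.zero_le j).trans_lt hj
  by_cases h : IsQuantumChannel (S.step t n i j)
  · simpa [Ch, h] using h.norm_toTraceNorm_le
  · have hj' : ((j : ℝ) + 1) ≤ n := by exact_mod_cast hj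
    refine ((S.isEvolution_term t i).norm_le_exp ContinuousLinearMap.norm_id_le
      (s := t * j / n) (r := t * (j + 1) / n) (by positivity) (by gcongr; linarith)
      (by rw [div_le_iff₀ hn]; gcongr)).trans (le_of_eq ?_)
    rw [Ch, if_neg h]
    congr 2
    push_cast
    ring

/-- The decomposition error is governed by the total indivisible time of the local terms. -/
theorem trotterError_le {t : ℝ} (ht : 0 ≤ t) {tIDs : Fin K → ℝ} (h : S.IsIndivisibleTimes t tIDs)
    {m : ℕ} (hm : 0 < m) :
    S.trotterError t m ≤
      2 * K ^ 2 * S.beta t ^ 2 * t ^ 2 / m * Real.exp (S.beta t * ∑ i, tIDs i) := by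
  have hβ := S.beta_nonneg t
  have h1 : ‖(1 : TraceNormMatrix (Λ → Fin d) →L[ℂ] TraceNormMatrix (Λ → Fin d))‖ ≤ 1 :=
    ContinuousLinearMap.norm_id_le
  have hex : ∀ i, ∃ g : ℝ → ℝ, MonotoneOn g (Icc 0 t) ∧ g t - g 0 ≤ S.beta t * tIDs i ∧
      ∀ s r, 0 ≤ s → s ≤ r → r ≤ t →
        ‖toTraceNorm _ (propagator (S.term i) r s)‖ ≤ Real.exp (g r - g s) := by
    intro i
    -- The weights of the n-th grid sum to β times `numIndivisible * t / n`, which converges to β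
    -- tᵢᴵᴰ by hypothesis.
    refine (S.isEvolution_term t i).exists_growth h1 hβ
      (x := fun n j => S.beta t * (Ch (S.step t n i j) * (t / n))) (fun n j => by positivity)
      (fun n j hj => S.norm_step_le hj ht i) ht ?_
    refine ((h i).const_mul (S.beta t)).congr fun n => ?_
    rw [numIndivisible, ← Finset.mul_sum, ← Finset.sum_mul]
    push_cast
    ring
  choose g hg hgt hgU using hex
  have hm' : (0 : ℝ) < m := by exact_mod_cast hm
  have key := norm_sub_trotter_le h1 hβ (S.isEvolution_term t) (S.isEvolution_liouvillian t) hg hgU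
    (fun s r hs hsr hrt => norm_le_exp_sum h1 hβ (S.isEvolution_term t)
      (S.isEvolution_liouvillian t) hgU hs hsr hrt)
    (fun j => t * j / m) (τ := t / m) (by positivity) (by simp)
    (fun j => by push_cast; ring) m (by rw [mul_div_assoc, div_self hm'.ne', mul_one])
  have e : t * (m : ℝ) / m = t := by rw [mul_div_assoc, div_self hm'.ne', mul_one]
  rw [trotterError, ← norm_toTraceNorm, map_sub, trotter, map_list_prod, List.map_reverse,
    List.map_ofFn]
  have e2 : (toTraceNorm (Λ → Fin d) ∘ fun j : Fin m =>
      (List.ofFn fun i => S.step t m i j).reverse.prod) = fun j : Fin m =>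
      (List.ofFn fun i => toTraceNorm _ (propagator (S.term i) (t * ((j + 1 : ℕ) : ℝ) / m)
        (t * (j : ℕ) / m))).reverse.prod := by
    funext j
    rw [Function.comp_apply, map_list_prod, List.map_reverse, List.map_ofFn]
    simp only [Function.comp_def, step, Nat.cast_add, Nat.cast_one]
  rw [e2]
  simp only [e, Nat.cast_zero, mul_zero, zero_div] at key
  refine key.trans ?_
  have e3 : (m : ℝ) * (2 * K ^ 2 * S.beta t ^ 2 * (t / m) ^ 2) =
      2 * K ^ 2 * S.beta t ^ 2 * t ^ 2 / m := by
    field_simp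
  rw [e3]
  have e4 : ∑ i, g i t - ∑ i, g i 0 ≤ S.beta t * ∑ i, tIDs i := by
    rw [← Finset.sum_sub_distrib, Finset.mul_sum]
    exact Finset.sum_le_sum fun i _ => hgt i
  gcongr

theorem isQuantumChannel_step {t : ℝ} (ht : 0 ≤ t) (h : S.LocallyDivisible t) {n j : ℕ}
    (hj : j < n) (i : Fin K) : IsQuantumChannel (S.step t n i j) := by
  have hn : (0 : ℝ) < n := by exact_mod_cast (Nat.zero_le j).trans_lt hj
  have hj' : ((j : ℝ) + 1) ≤ n := by exact_mod_cast hj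
  exact h i _ _ (by positivity) (by gcongr; linarith) (by rw [div_le_iff₀ hn]; gcongr)

theorem LocallyDivisible.isIndivisibleTimes {S : LocalSystem Λ d k K} {t : ℝ} (ht : 0 ≤ t)
    (h : S.LocallyDivisible t) : S.IsIndivisibleTimes t (fun _ => 0) := by
  intro i
  refine tendsto_const_nhds.congr fun n => ?_
  have : S.numIndivisible t n i = 0 := Finset.sum_eq_zero fun j hj => by
    simp [Ch, S.isQuantumChannel_step ht h (Finset.mem_range.1 hj) i]
  simp [this]

theorem LocallyDivisible.isTransitionNumbers {S : LocalSystem Λ d k K} {t : ℝ} (ht : 0 ≤ t)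
    (h : S.LocallyDivisible t) : S.IsTransitionNumbers t (fun _ => 0) := by
  intro i
  refine tendsto_const_nhds.congr fun n => ?_
  have : S.numTransitions t n i = 0 := Finset.sum_eq_zero fun j hj => by
    -- The second cell of each pair still belongs to the grid, so it is a channel and the pair is
    -- not counted.
    have hj' : j + 1 < n := by
      have := Finset.mem_range.1 hj
      omega
    simp [Ch, S.isQuantumChannel_step ht h hj' i]
  simp [this]

end LocalSystem

theorem corollary1 {Λ : Type*} [Fintype Λ] [DecidableEq Λ] {d k K : ℕ}
    (S : LocalSystem Λ d k K) (t : ℝ) (ht : 0 ≤ t) :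
    (∀ tIDs Cs : Fin K → ℝ, S.IsIndivisibleTimes t tIDs → S.IsTransitionNumbers t Cs →
      ∀ tID C β : ℝ, tID = ⨆ i, tIDs i → C = 2 * ⨆ i, Cs i → β = S.beta t →
        ∀ ε : ℝ, 0 ≤ ε →
          ε ≤ 2 * K ^ 2 * β * t * Real.log 2 * Real.exp ((K + K ^ 2) * tID * β) /
            (3 + (3 + C * K + C * K ^ 2)) →
          ∀ m : ℕ, 0 < m →
            2 * K ^ 2 * β ^ 2 * t ^ 2 * Real.exp ((K + K ^ 2) * tID * β) ≤ m * ε →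
            S.trotterError t m ≤ ε) ∧
    (S.LocallyDivisible t →
      S.IsIndivisibleTimes t (fun _ => 0) ∧ S.IsTransitionNumbers t (fun _ => 0) ∧
      ∀ ε : ℝ, 0 ≤ ε → ε ≤ 2 * K ^ 2 * S.beta t * t * Real.log 2 / 6 →
        ∀ m : ℕ, 0 < m → 2 * K ^ 2 * S.beta t ^ 2 * t ^ 2 ≤ m * ε →
          S.trotterError t m ≤ ε) := by
  constructor
  · rintro tIDs Cs hID - tID C β rfl - rfl ε - - m hm hmε
    have hβ := S.beta_nonneg t
    have hm' : (0 : ℝ) < m := by exact_mod_cast hm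
    have h0 : ∀ i, 0 ≤ tIDs i := fun i => ge_of_tendsto' (hID i) fun n => by positivity
    have hT : 0 ≤ ⨆ i, tIDs i := Real.iSup_nonneg h0
    -- K times the maximum already bounds the sum; the K² summand is slack. For K = 0 the supremum
    -- takes the default value 0.
    have hsum : ∑ i, tIDs i ≤ (K + K ^ 2) * ⨆ i, tIDs i := by
      have h1 : ∑ i, tIDs i ≤ K * ⨆ i, tIDs i := by
        refine (Finset.sum_le_sum fun i _ => le_ciSup (Finite.bddAbove_range tIDs) i).trans
          (le_of_eq ?_)
        simp
      have h2 : 0 ≤ (K : ℝ) ^ 2 * ⨆ i, tIDs i := by positivity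
      linarith
    refine (S.trotterError_le ht hID hm).trans ?_
    rw [div_mul_eq_mul_div, div_le_iff₀ hm', mul_comm ε]
    refine le_trans ?_ hmε
    rw [mul_comm _ (S.beta t)]
    gcongr
  · intro hdiv
    have hID := hdiv.isIndivisibleTimes ht
    refine ⟨hID, hdiv.isTransitionNumbers ht, fun ε _ _ m hm hmε => ?_⟩
    have hm' : (0 : ℝ) < m := by exact_mod_cast hm
    refine (S.trotterError_le ht hID hm).trans ?_
    rw [Finset.sum_const_zero, mul_zero, Real.exp_zero, mul_one, div_le_iff₀ hm', mul_comm ε]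
    exact hmε
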